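/- Let $\mathbb D$ be the open unit disk and $\partial\mathbb D$ the unit circle. For sequences $\alpha\in\mathbb D^{\mathbb Z}$, $\lambda\in(\partial\mathbb D)^{\mathbb Z}$, put $\rho_n=\sqrt{1-|\alpha_n|^2}$ and $$\Theta(\alpha_n,\lambda_n)=\lambda_n\begin{bmatrix}\overline{\alpha_n}&\rho_n\\ \rho_n&-\alpha_n\end{bmatrix}.$$ The extended pCMV matrix of $(\alpha,\lambda)$ is the unitary operator $\mathcal E_{\alpha,\lambda}=\mathcal L\mathcal M$ on $\ell^2(\mathbb Z)$, where $\mathcal L=\bigoplus_{j\in\mathbb Z}\Theta(\alpha_{2j},\lambda_{2j})$, $\mathcal M=\bigoplus_{j\in\mathbb Z}\Theta(\alpha_{2j+1},\lambda_{2j+1})$, and $\Theta(\alpha_k,\lambda_k)$ acts on $\ell^2(\{k,k+1\})$. Let $(\Omega,\mu)$ be a probability space, $S:\Omega\to\Omega$ an invertible bi-measurable transformation for which $\mu$ is (invariant and) ergodic, and let $f:\Omega\to\mathbb D$ and $g:\Omega\to\partial\mathbb D$ be measurable with $|f|\le C<1$ $\mu$-almost everywhere for some constant $C$. Let $\mathcal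 E(\omega)=\mathcal E_{\alpha(\omega),\lambda(\omega)}$ with $\alpha_n(\omega)=f(S^n\omega)$, $\lambda_n(\omega)=g(S^n\omega)$, $n\in\mathbb Z$. Put $$\log\rho_\infty=\tfrac12\int_\Omega\log(1-|f|^2)\,d\mu,\qquad c=\log(2/\rho_\infty).$$ Let $\mathrm{Leb}$ be arc length measure on $\partial\mathbb D$, and let $\chi_n:\ell^2(\mathbb Z)\to\ell^2([-n,n]\cap\mathbb Z)$ be the canonical projection. **Theorem.** One has $c>0$, and there is a probability measure $\nu$ on $\partial\mathbb D$, the density of states of the family, such that for $\mu$-almost every $\omega$, $$\lim_{n\to\infty}\frac1{2n+1}\,\mathrm{tr}\bigl(\chi_n\,h(\mathcal E(\omega))\,\chi_n^*\bigr)=\int h\,d\nu\qquad\text{for every continuous } h .$$ It is log-Hölder continuous: $$\nu(A)\le\frac{-c}{\log\mathrm{Leb}(A)}\qquad\text{for every arc }A\subseteq\partial\mathbb D\text{ with }\mathrm{Leb}(A)<\tfrac12,$$ where the right-hand side is read as $0$ if $\mathrm{Leb}(A)=0$. Moreover, for $\mu$-almost every $\omega$ the following holds: if the normalized eigenvalue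 counting measures $\nu_n$ of the $(2n+1)\times(2n+1)$ matrices $\chi_n\mathcal E(\omega)\chi_n^*$ (probability measures on $\mathbb C$; algebraic multiplicities are counted) converge weak$^*$ to a probability measure $\nu'$ on $\mathbb C$, then $\nu'$ satisfies the same bound for the same arcs, and $\nu'=\nu$ if $\nu'$ is carried by $\partial\mathbb D$. -/

import Mathlib

open MeasureTheory Filter Topology
open scoped ENNReal ComplexConjugate

noncomputable section

namespace PCMV

/-- The open unit disk. -/
abbrev Disk : Type := Metric.ball (0 : ℂ) 1

/-- The unit circle. -/
abbrev UCircle : Type := Metric.sphere (0 : ℂ) 1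

/-- The Hilbert space of square summable complex sequences on the integers. -/
abbrev HilbertZ : Type := lp (fun _ : ℤ => ℂ) 2

/-- The number `ρ = √(1 - |α|²)`. -/
def rho (a : Disk) : ℝ := Real.sqrt (1 - ‖(a : ℂ)‖ ^ 2)

/-- The unitary matrix `Θ(α, λ)`. -/
def Theta (a : Disk) (l : UCircle) : Matrix (Fin 2) (Fin 2) ℂ :=
  (l : ℂ) • !![conj (a : ℂ), (rho a : ℂ); (rho a : ℂ), -(a : ℂ)]

theorem norm_rho_le (a : Disk) : ‖(rho a : ℂ)‖ ≤ 1 := by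
  rw [Complex.norm_real, Real.norm_eq_abs, rho, abs_of_nonneg (Real.sqrt_nonneg _)]
  exact Real.sqrt_le_one.mpr (by nlinarith [sq_nonneg ‖(a : ℂ)‖])

theorem norm_Theta_le (a : Disk) (l : UCircle) (i j : Fin 2) : ‖Theta a l i j‖ ≤ 1 := by
  have ha : ‖(a : ℂ)‖ ≤ 1 := (mem_ball_zero_iff.mp a.2).le
  have hl : ‖(l : ℂ)‖ = 1 := mem_sphere_zero_iff_norm.mp l.2
  have hr : |rho a| ≤ 1 := by simpa using norm_rho_le a
  fin_cases i <;> fin_cases j <;> simp [Theta, hl, ha, hr]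

/-- The action on sequences of the direct sum over the integers `j` of the blocks
`Θ(α_{2j+s}, λ_{2j+s})`, each acting on the coordinates `{2j+s, 2j+s+1}`. -/
def thetaFun (a : ℤ → Disk) (l : ℤ → UCircle) (s : ℤ) (u : ℤ → ℂ) (n : ℤ) : ℂ :=
  if Even (n - s) then
    Theta (a n) (l n) 0 0 * u n + Theta (a n) (l n) 0 1 * u (n + 1)
  else
    Theta (a (n - 1)) (l (n - 1)) 1 0 * u (n - 1) + Theta (a (n - 1)) (l (n - 1)) 1 1 * u n

theorem norm_thetaFun_sq_le (a : ℤ → Disk) (l : ℤ → UCircle) (s : ℤ) (u : ℤ → ℂ) (n : ℤ) :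
    ‖thetaFun a l s u n‖ ^ 2 ≤ 2 * ‖u n‖ ^ 2 + (2 * ‖u (n + 1)‖ ^ 2 + 2 * ‖u (n - 1)‖ ^ 2) := by
  have key : ∀ x y p q : ℂ, ‖x‖ ≤ 1 → ‖y‖ ≤ 1 →
      ‖x * p + y * q‖ ^ 2 ≤ 2 * ‖p‖ ^ 2 + 2 * ‖q‖ ^ 2 := by
    intro x y p q hx hy
    have h : ‖x * p + y * q‖ ≤ ‖p‖ + ‖q‖ := by
      refine (norm_add_le _ _).trans ?_
      rw [norm_mul, norm_mul]
      nlinarith [norm_nonneg p, norm_nonneg q]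
    nlinarith [norm_nonneg (x * p + y * q), sq_nonneg (‖p‖ - ‖q‖)]
  unfold thetaFun
  split_ifs
  · have := key _ _ (u n) (u (n + 1)) (norm_Theta_le (a n) (l n) 0 0) (norm_Theta_le (a n) (l n) 0 1)
    nlinarith [sq_nonneg ‖u (n - 1)‖]
  · have := key _ _ (u (n - 1)) (u n) (norm_Theta_le (a (n - 1)) (l (n - 1)) 1 0)
      (norm_Theta_le (a (n - 1)) (l (n - 1)) 1 1)
    nlinarith [sq_nonneg ‖u (n + 1)‖]

theorem hasSum_sq (u : HilbertZ) : HasSum (fun n => ‖u n‖ ^ 2) (‖u‖ ^ 2) := by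
  have := lp.hasSum_norm (p := 2) (by norm_num) u
  simpa using this

theorem hasSum_bound (u : HilbertZ) :
    HasSum (fun n => 2 * ‖u n‖ ^ 2 + (2 * ‖u (n + 1)‖ ^ 2 + 2 * ‖u (n - 1)‖ ^ 2))
      (2 * ‖u‖ ^ 2 + (2 * ‖u‖ ^ 2 + 2 * ‖u‖ ^ 2)) := by
  have aux : ∀ (F : ℤ → ℝ) (t : ℝ), HasSum F t →
      HasSum (fun n => 2 * F n + (2 * F (n + 1) + 2 * F (n - 1))) (2 * t + (2 * t + 2 * t)) := by
    intro F t h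
    have h1 : HasSum (fun n => F (n + 1)) t := (Equiv.addRight (1 : ℤ)).hasSum_iff.mpr h
    have h2 : HasSum (fun n => F (n - 1)) t := (Equiv.subRight (1 : ℤ)).hasSum_iff.mpr h
    exact (h.mul_left 2).add ((h1.mul_left 2).add (h2.mul_left 2))
  exact aux (fun n => ‖u n‖ ^ 2) _ (hasSum_sq u)

theorem memℓp_thetaFun (a : ℤ → Disk) (l : ℤ → UCircle) (s : ℤ) (u : HilbertZ) :
    Memℓp (thetaFun a l s u) 2 := by
  refine memℓp_gen ?_
  have : Summable fun n => ‖thetaFun a l s u n‖ ^ 2 :=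
    Summable.of_nonneg_of_le (fun n => sq_nonneg _) (norm_thetaFun_sq_le a l s u)
      (hasSum_bound u).summable
  simpa using this

/-- The bounded operator on `ℓ²(ℤ)` that is the direct sum over the integers `j` of the blocks
`Θ(α_{2j+s}, λ_{2j+s})`, each acting on `ℓ²({2j+s, 2j+s+1})`. -/
def thetaSum (a : ℤ → Disk) (l : ℤ → UCircle) (s : ℤ) : HilbertZ →L[ℂ] HilbertZ :=
  LinearMap.mkContinuous
    { toFun := fun u => ⟨thetaFun a l s u, memℓp_thetaFun a l s u⟩
      map_add' := by
        intro u v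
        ext n
        change thetaFun a l s (u + v : HilbertZ) n = thetaFun a l s u n + thetaFun a l s v n
        simp only [thetaFun, lp.coeFn_add, Pi.add_apply]
        split_ifs <;> ring
      map_smul' := by
        intro c u
        ext n
        change thetaFun a l s (c • u : HilbertZ) n = c * thetaFun a l s u n
        simp only [thetaFun, lp.coeFn_smul, Pi.smul_apply, smul_eq_mul]
        split_ifs <;> ring } 3 (by
    intro u
    have h1 := hasSum_sq (⟨thetaFun a l s u, memℓp_thetaFun a l s u⟩ : HilbertZ)
    have h2 := hasSum_le (norm_thetaFun_sq_le a l s u) h1 (hasSum_bound u)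
    refine abs_le_of_sq_le_sq' ?_ (by positivity) |>.2
    refine h2.trans ?_
    nlinarith [sq_nonneg ‖u‖])

/-- The operator `𝓛 = ⨁ Θ(α_{2j}, λ_{2j})`. -/
def opL (a : ℤ → Disk) (l : ℤ → UCircle) : HilbertZ →L[ℂ] HilbertZ := thetaSum a l 0

/-- The operator `𝓜 = ⨁ Θ(α_{2j+1}, λ_{2j+1})`. -/
def opM (a : ℤ → Disk) (l : ℤ → UCircle) : HilbertZ →L[ℂ] HilbertZ := thetaSum a l 1

/-- The extended phased CMV (pCMV) operator `𝓔 = 𝓛𝓜` on `ℓ²(ℤ)`. -/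
def pCMV (a : ℤ → Disk) (l : ℤ → UCircle) : HilbertZ →L[ℂ] HilbertZ := opL a l ∘L opM a l

/-- The standard basis vector `δ_k` of `ℓ²(ℤ)`. -/
def delta (k : ℤ) : HilbertZ := lp.single 2 k (1 : ℂ)

/-- The member `𝓔(ω)` of the dynamically defined family with `α_n(ω) = f(Sⁿω)` and
`λ_n(ω) = g(Sⁿω)`, for all integers `n`. -/
def dynPCMV {Ω : Type*} [MeasurableSpace Ω] (S : Ω ≃ᵐ Ω) (f : Ω → Disk) (g : Ω → UCircle)
    (ω : Ω) : HilbertZ →L[ℂ] HilbertZ :=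
  pCMV (fun n => f ((S.toEquiv ^ n : Equiv.Perm Ω) ω))
    (fun n => g ((S.toEquiv ^ n : Equiv.Perm Ω) ω))

/-- The density of states measure of an operator, as a measure carried by the unit circle:
the weak* limit of the measures `h ↦ (2n+1)⁻¹ tr(χ_n h(E) χ_n*)`, where `χ_n` is the projection
onto `ℓ²([-n, n])` and `h(E)` is given by the continuous functional calculus. -/
def IsDOS (E : HilbertZ →L[ℂ] HilbertZ) (ν : Measure ℂ) : Prop :=
  IsProbabilityMeasure ν ∧ ν (Metric.sphere (0 : ℂ) 1)ᶜ = 0 ∧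
    ∀ h : ℂ → ℂ, Continuous h →
      Tendsto (fun n : ℕ => (2 * n + 1 : ℂ)⁻¹ *
          ∑ k ∈ Finset.Icc (-(n : ℤ)) n, inner ℂ (delta k) (cfc h E (delta k)))
        atTop (𝓝 (∫ z, h z ∂ν))

/-- The restriction `χ_n E χ_n*` of an operator to `ℓ²([-n, n])` with Dirichlet boundary
conditions, as a square matrix of size `2n + 1`. -/
def dirichletMatrix (E : HilbertZ →L[ℂ] HilbertZ) (n : ℕ) :
    Matrix (Finset.Icc (-(n : ℤ)) n) (Finset.Icc (-(n : ℤ)) n) ℂ :=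
  fun i j => inner ℂ (delta i) (E (delta j))

/-- The normalized eigenvalue counting measure of `χ_n E χ_n*`; eigenvalues are counted with
algebraic multiplicity, so that there are `2n + 1` of them. -/
def countingMeasure (E : HilbertZ →L[ℂ] HilbertZ) (n : ℕ) : Measure ℂ :=
  (2 * n + 1 : ℝ≥0∞)⁻¹ • ((dirichletMatrix E n).charpoly.roots.map Measure.dirac).sum

/-- The measure `ν` is the weak* limit of the normalized eigenvalue counting measures of the
Dirichlet restrictions `χ_n E χ_n*`. -/
def IsDirichletDOS (E : HilbertZ →L[ℂ] HilbertZ) (ν : Measure ℂ) : Prop :=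
  IsProbabilityMeasure ν ∧
    ∀ h : BoundedContinuousFunction ℂ ℝ,
      Tendsto (fun n : ℕ => ∫ z, h z ∂(countingMeasure E n)) atTop (𝓝 (∫ z, h z ∂ν))

/-- Arc length measure on the unit circle, as a measure on the complex plane. -/
def arcLeb : Measure ℂ :=
  (volume.restrict (Set.Ioc (-Real.pi) Real.pi)).map fun θ : ℝ => Complex.exp (θ * Complex.I)

/-- Arcs of the unit circle: images of intervals (open, closed, half-open, possibly degenerate)
under `θ ↦ exp(iθ)`. -/
def IsArc (A : Set ℂ) : Prop :=
  ∃ J : Set ℝ, J.OrdConnected ∧ A = (fun θ : ℝ => Complex.exp (θ * Complex.I)) '' J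

/-- The bound `ν(A) ≤ -c / log Leb(A)` for every arc `A` with `Leb(A) < 1/2`. For an arc that is
empty or a single point, where `log Leb(A) = -∞`, it says `ν(A) = 0`. -/
def LogHolderBound (c : ℝ) (ν : Measure ℂ) : Prop :=
  ∀ A : Set ℂ, IsArc A → arcLeb.real A < 1 / 2 → ν.real A ≤ -c / Real.log (arcLeb.real A)

/-- The constant `ρ_∞`, where `log ρ_∞ = ½ ∫ log(1 - |f|²) dμ`. -/
def rhoInf {Ω : Type*} [MeasurableSpace Ω] (μ : Measure Ω) (f : Ω → Disk) : ℝ :=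
  Real.exp ((1 / 2) * ∫ ω, Real.log (1 - ‖(f ω : ℂ)‖ ^ 2) ∂μ)

end PCMV

end

/-! The core is a lower bound for the characteristic polynomial of the Dirichlet restriction: for
|z| ≥ 1, |z| |det(z - χ_n 𝓔 χ_n*)| ≥ ρ_{-n-1} ∏_{|k|≤n} ρ_k (`prod_rho_le_norm_det`). Extend the
window to [-n, n+1], which blocks Θ of one parity fill exactly. There they form a unitary L, and the
truncated blocks of the other parity form a contraction C. Up to transposition the restriction is
the corner of LC, and the last column of LC vanishes, so the quantity to bound is |det(zL* - C)|.
This matrix is tridiagonal with superdiagonal entries of modulus at least ρ_k, so a corner entry of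
its adjugate is at least their product. A norm balance for the corresponding adjugate column
transfers this to the determinant.

All eigenvalues w therefore lie in the open disk, and by Birkhoff's theorem any limit of the mean of
log|z - w|, |z| > 1, is at least log ρ_∞. Any measure whose potential obeys this bound off the disk
is log-Hölder continuous with c = log 2 - log ρ_∞: let z tend radially to a point of an arc A; the
integrand is at most log Leb(A) on A and log 2 elsewhere
(`logHolderBound_of_le_integral_logPotential`, after Craig and Simon).

The density of states comes from the moments tr(χ_n 𝓔^m χ_n*)/(2n+1). Shifting ω by S exchanges the
roles of 𝓛 and 𝓜, so diagonal entries of 𝓔^m are stationary only under S², which need not be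
ergodic. The sum of two neighbouring diagonal entries is stationary under S (`pairTrace_dynPCMV`),
so the moments converge almost surely to constants. A limit functional and the Riesz–Markov theorem
turn these constants into ν.

Restricting before or after taking powers changes traces by O(m), so eigenvalue power sums have the
same limits. Since log|z - w| is a uniform limit on the closed disk of real parts of polynomials in
w, the potential bound passes to ν even if the counting measures do not converge. A weak limit ν' is
tested on the potential directly. Holomorphic moments determine a measure on the circle but not on
the disk: for f = 0 all the eigenvalues vanish. Hence the proviso in ν' = ν. -/

noncomputable section

/-! ### Birkhoff's pointwise ergodic theorem, one- and two-sided -/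

section Birkhoff

variable {Ω : Type*}

/-- The running maximum of the Birkhoff sums `0, g, g + g ∘ T, …` -/
def birkhoffMax (T : Ω → Ω) (g : Ω → ℝ) : ℕ → Ω → ℝ
  | 0 => fun _ => 0
  | n + 1 => fun x => max 0 (g x + birkhoffMax T g n (T x))

theorem birkhoffMax_nonneg (T : Ω → Ω) (g : Ω → ℝ) (n : ℕ) (x : Ω) : 0 ≤ birkhoffMax T g n x := by
  cases n with
  | zero => exact le_rfl
  | succ n => exact le_max_left _ _

theorem birkhoffMax_le_succ (T : Ω → Ω) (g : Ω → ℝ) (n : ℕ) (x : Ω) :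
    birkhoffMax T g n x ≤ birkhoffMax T g (n + 1) x := by
  induction n generalizing x with
  | zero => exact birkhoffMax_nonneg _ _ _ _
  | succ n ih => exact max_le_max le_rfl (by linarith [ih (T x)])

theorem birkhoffSum_le_birkhoffMax (T : Ω → Ω) (g : Ω → ℝ) (n : ℕ) (x : Ω) :
    birkhoffSum T g n x ≤ birkhoffMax T g n x := by
  induction n generalizing x with
  | zero => simp [birkhoffMax]
  | succ n ih =>
    rw [birkhoffSum_succ']
    exact (by linarith [ih (T x)] : _ ≤ g x + birkhoffMax T g n (T x)).trans (le_max_right _ _)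

variable [MeasurableSpace Ω] {μ : Measure Ω}

theorem measurable_birkhoffMax {T : Ω → Ω} (hT : Measurable T) {g : Ω → ℝ} (hg : Measurable g)
    (n : ℕ) : Measurable (birkhoffMax T g n) := by
  induction n with
  | zero => exact measurable_const
  | succ n ih => exact measurable_const.max (hg.add (ih.comp hT))

theorem integrable_birkhoffMax {T : Ω → Ω} (hT : MeasurePreserving T μ μ) {g : Ω → ℝ}
    (hg : Integrable g μ) (n : ℕ) : Integrable (birkhoffMax T g n) μ := by
  induction n with
  | zero => exact integrable_zero _ _ _
  | succ n ih => exact (integrable_zero _ _ _).sup (hg.add (hT.integrable_comp_of_integrable ih))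

/-- For an ergodic map, the Birkhoff sums of a function of negative mean are a.e. bounded above. -/
theorem Ergodic.ae_bddAbove_birkhoffSum [IsProbabilityMeasure μ] {T : Ω → Ω} (hT : Ergodic T μ)
    {g : Ω → ℝ} (hgm : Measurable g) (hg : Integrable g μ) (hneg : ∫ x, g x ∂μ < 0) :
    ∀ᵐ x ∂μ, ∃ K : ℝ, ∀ n, birkhoffSum T g n x ≤ K := by
  set A : Set Ω := {x | ∀ K : ℕ, ∃ n, (K : ℝ) ≤ birkhoffMax T g n x} with hA
  have hmono : ∀ x, Monotone fun n => birkhoffMax T g n x := fun x =>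
    monotone_nat_of_le_succ fun n => birkhoffMax_le_succ T g n x
  have hAm : MeasurableSet A := by
    rw [hA, Set.ofPred_forall]
    refine MeasurableSet.iInter fun K => ?_
    rw [Set.ofPred_exists]
    exact MeasurableSet.iUnion fun n =>
      measurableSet_le measurable_const (measurable_birkhoffMax hT.measurable hgm n)
  have hAinv : T ⁻¹' A = A := by
    ext x
    constructor
    · intro h K
      obtain ⟨n, hn⟩ := h (K + ⌈-g x⌉₊)
      refine ⟨n + 1, le_trans ?_ (le_max_right _ _)⟩
      push_cast at hn
      linarith [Nat.le_ceil (-g x)]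
    · intro h K
      -- The extra 1 excludes the branch in which the maximum is 0.
      obtain ⟨n, hn⟩ := h (K + 1 + ⌈g x⌉₊)
      have h1 : ((K + 1 + ⌈g x⌉₊ : ℕ) : ℝ) ≤ max 0 (g x + birkhoffMax T g n (T x)) :=
        hn.trans (birkhoffMax_le_succ T g n x)
      refine ⟨n, ?_⟩
      push_cast at h1
      rcases le_max_iff.mp h1 with h2 | h2
      · have : (0 : ℝ) ≤ (K : ℝ) + (⌈g x⌉₊ : ℝ) := by positivity
        linarith
      · linarith [Nat.le_ceil (g x)]
  rcases hT.toPreErgodic.ae_mem_or_ae_notMem hAm hAinv with h | h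
  · exfalso
    -- If the running maxima are almost surely unbounded, the cut-off at 0 is eventually inactive,
    -- so M_{n+1} - M_n ∘ T is eventually equal to g. It is dominated by |g|, and its integral is ∫
    -- (M_{n+1} - M_n) ≥ 0 by invariance, which contradicts ∫ g < 0.
    have hlim : ∀ᵐ x ∂μ, Tendsto (fun n => birkhoffMax T g (n + 1) x - birkhoffMax T g n (T x))
        atTop (𝓝 (g x)) := by
      filter_upwards [h] with x hx
      have hx' : T x ∈ A := by rw [← Set.mem_preimage, hAinv]; exact hx
      obtain ⟨n₀, hn₀⟩ := hx' ⌈-g x⌉₊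
      refine tendsto_const_nhds.congr' ?_
      filter_upwards [eventually_ge_atTop n₀] with n hn
      have h1 := hmono (T x) hn
      have h2 := Nat.le_ceil (-g x)
      change _ = max 0 (g x + birkhoffMax T g n (T x)) - _
      simp only at h1
      rw [max_eq_right (by linarith)]
      ring
    have hdom : Tendsto (fun n => ∫ x, (birkhoffMax T g (n + 1) x - birkhoffMax T g n (T x)) ∂μ)
        atTop (𝓝 (∫ x, g x ∂μ)) := by
      refine tendsto_integral_of_dominated_convergence (fun x => |g x|) (fun n => ?_) hg.abs
        (fun n => ae_of_all _ fun x => ?_) hlim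
      · exact ((measurable_birkhoffMax hT.measurable hgm _).sub
          ((measurable_birkhoffMax hT.measurable hgm n).comp hT.measurable)).aestronglyMeasurable
      · have h1 := birkhoffMax_nonneg T g n (T x)
        change |max 0 (g x + birkhoffMax T g n (T x)) - _| ≤ _
        rcases le_total 0 (g x + birkhoffMax T g n (T x)) with h2 | h2
        · rw [max_eq_right h2, add_sub_cancel_right]
        · rw [max_eq_left h2, zero_sub, abs_neg, abs_of_nonneg h1]
          exact le_trans (by linarith) (neg_le_abs (g x))
    refine absurd (ge_of_tendsto' hdom fun n => ?_) (not_le.mpr hneg)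
    have hi := integrable_birkhoffMax hT.toMeasurePreserving hg
    have hc : ∫ x, birkhoffMax T g n (T x) ∂μ = ∫ x, birkhoffMax T g n x ∂μ := by
      conv_rhs => rw [← hT.toMeasurePreserving.map_eq]
      rw [integral_map hT.measurable.aemeasurable
        (measurable_birkhoffMax hT.measurable hgm n).aestronglyMeasurable]
    have hi' : Integrable (fun x => birkhoffMax T g n (T x)) μ :=
      hT.toMeasurePreserving.integrable_comp_of_integrable (hi n)
    rw [integral_sub (hi _) hi', hc, sub_nonneg]
    exact integral_mono (hi _) (hi _) fun x => birkhoffMax_le_succ T g n x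
  · filter_upwards [h] with x hx
    simp only [hA, Set.mem_ofPred_eq, not_forall, not_exists, not_le] at hx
    obtain ⟨K, hK⟩ := hx
    exact ⟨K, fun n => (birkhoffSum_le_birkhoffMax T g n x).trans (hK n).le⟩

theorem Ergodic.ae_eventually_birkhoffSum_le [IsProbabilityMeasure μ] {T : Ω → Ω}
    (hT : Ergodic T μ) {g : Ω → ℝ} (hgm : Measurable g) (hg : Integrable g μ) {ε : ℝ}
    (hε : 0 < ε) :
    ∀ᵐ x ∂μ, ∀ᶠ n : ℕ in atTop, birkhoffSum T g n x ≤ n * (∫ x, g x ∂μ + ε) := by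
  -- Subtracting the mean and half of ε makes the mean negative; the other half of ε absorbs the
  -- bound K once n ≥ 2K/ε.
  have h1 := hT.ae_bddAbove_birkhoffSum (g := fun x => g x - (∫ x, g x ∂μ + ε / 2))
    (hgm.sub measurable_const) (hg.sub (integrable_const _))
    (by rw [integral_sub hg (integrable_const _)]; simp; linarith)
  filter_upwards [h1] with x hx
  obtain ⟨K, hK⟩ := hx
  filter_upwards [eventually_ge_atTop ⌈K / (ε / 2)⌉₊] with n hn
  have h2 := hK n
  have h3 : K / (ε / 2) ≤ n := (Nat.le_ceil _).trans (by exact_mod_cast hn)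
  rw [div_le_iff₀ (by positivity)] at h3
  simp only [birkhoffSum, Finset.sum_sub_distrib, Finset.sum_const, Finset.card_range,
    nsmul_eq_mul] at h2 ⊢
  linarith

/-- **Birkhoff's pointwise ergodic theorem** for an ergodic probability-preserving map. -/
theorem Ergodic.tendsto_birkhoffSum_div [IsProbabilityMeasure μ] {T : Ω → Ω} (hT : Ergodic T μ)
    {g : Ω → ℝ} (hgm : Measurable g) (hg : Integrable g μ) :
    ∀ᵐ x ∂μ, Tendsto (fun n : ℕ => birkhoffSum T g n x / n) atTop (𝓝 (∫ x, g x ∂μ)) := by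
  have h1 : ∀ᵐ x ∂μ, ∀ k : ℕ, ∀ᶠ n : ℕ in atTop,
      birkhoffSum T g n x ≤ n * (∫ x, g x ∂μ + 1 / ((k : ℝ) + 1)) :=
    ae_all_iff.mpr fun k => hT.ae_eventually_birkhoffSum_le hgm hg Nat.one_div_pos_of_nat
  have h2 : ∀ᵐ x ∂μ, ∀ k : ℕ, ∀ᶠ n : ℕ in atTop,
      birkhoffSum T (fun x => -g x) n x ≤ n * (∫ x, -g x ∂μ + 1 / ((k : ℝ) + 1)) :=
    ae_all_iff.mpr fun k => hT.ae_eventually_birkhoffSum_le hgm.neg hg.neg Nat.one_div_pos_of_nat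
  filter_upwards [h1, h2] with x hx1 hx2
  rw [Metric.tendsto_nhds]
  intro ε hε
  obtain ⟨k, hk⟩ := exists_nat_one_div_lt hε
  filter_upwards [hx1 k, hx2 k, eventually_gt_atTop 0] with n h1 h2 hn
  have hn' : (0 : ℝ) < n := by exact_mod_cast hn
  have h3 : birkhoffSum T (fun x => -g x) n x = -birkhoffSum T g n x := by
    simp [birkhoffSum]
  rw [h3, integral_neg] at h2
  refine lt_of_le_of_lt ?_ hk
  rw [Real.dist_eq, abs_le]
  constructor
  · rw [le_sub_iff_add_le, le_div_iff₀ hn']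
    linarith
  · rw [sub_le_iff_le_add, div_le_iff₀ hn']
    linarith

theorem sum_Icc_neg_self_succ {M : Type*} [AddCommMonoid M] (F : ℤ → M) (n : ℕ) :
    ∑ k ∈ Finset.Icc (-((n + 1 : ℕ) : ℤ)) ((n + 1 : ℕ) : ℤ), F k =
      ∑ k ∈ Finset.Icc (-(n : ℤ)) n, F k + (F (n + 1) + F (-(n + 1))) := by
  have h : Finset.Icc (-((n + 1 : ℕ) : ℤ)) ((n + 1 : ℕ) : ℤ) =
      insert ((n : ℤ) + 1) (insert (-((n : ℤ) + 1)) (Finset.Icc (-(n : ℤ)) n)) := by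
    ext k
    simp only [Finset.mem_Icc, Finset.mem_insert]
    push_cast
    omega
  rw [h, Finset.sum_insert, Finset.sum_insert]
  · rw [← add_assoc, add_comm]
  · simp only [Finset.mem_Icc]; omega
  · simp only [Finset.mem_Icc, Finset.mem_insert]; omega

theorem sum_Icc_neg_self_eq {M : Type*} [AddCommGroup M] (F : ℤ → M) (n : ℕ) :
    ∑ k ∈ Finset.Icc (-(n : ℤ)) n, F k =
      ∑ k ∈ Finset.range (n + 1), F k + ∑ k ∈ Finset.range (n + 1), F (-k) - F 0 := by
  induction n with
  | zero => simp
  | succ n ih =>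
    rw [sum_Icc_neg_self_succ, ih, Finset.sum_range_succ _ (n + 1),
      Finset.sum_range_succ _ (n + 1)]
    push_cast
    abel

/-- The two-sided form of Birkhoff's theorem for an invertible ergodic map. -/
theorem Ergodic.tendsto_sum_Icc_div [IsProbabilityMeasure μ] {S : Ω ≃ᵐ Ω} (hS : Ergodic S μ)
    {g : Ω → ℝ} (hgm : Measurable g) (hg : Integrable g μ) :
    ∀ᵐ x ∂μ, Tendsto (fun n : ℕ =>
      (∑ k ∈ Finset.Icc (-(n : ℤ)) n, g ((S.toEquiv ^ k : Equiv.Perm Ω) x)) / (2 * n + 1))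
      atTop (𝓝 (∫ x, g x ∂μ)) := by
  filter_upwards [hS.tendsto_birkhoffSum_div hgm hg, hS.symm.tendsto_birkhoffSum_div hgm hg]
    with x h1 h2
  have key : ∀ n : ℕ, ∑ k ∈ Finset.Icc (-(n : ℤ)) n, g ((S.toEquiv ^ k : Equiv.Perm Ω) x) =
      birkhoffSum S g (n + 1) x + birkhoffSum S.symm g (n + 1) x - g x := by
    intro n
    rw [sum_Icc_neg_self_eq]
    congr 2
    refine Finset.sum_congr rfl fun k _ => ?_
    rw [zpow_neg, zpow_natCast, ← inv_pow, Equiv.Perm.coe_pow]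
    rfl
  have hn : Tendsto (fun n : ℕ => (n : ℝ)) atTop atTop := tendsto_natCast_atTop_atTop
  have h3 : Tendsto (fun n : ℕ => ((n : ℝ) + 1) / (2 * n + 1)) atTop (𝓝 (1 / 2)) := by
    have : Tendsto (fun n : ℕ => 1 / 2 + (1 / 2) * (2 * (n : ℝ) + 1)⁻¹) atTop
        (𝓝 (1 / 2 + (1 / 2) * 0)) :=
      tendsto_const_nhds.add (tendsto_const_nhds.mul (tendsto_inv_atTop_zero.comp
        (tendsto_atTop_add_const_right _ _ (hn.const_mul_atTop two_pos))))
    rw [mul_zero, add_zero] at this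
    refine this.congr fun n => ?_
    field_simp
    ring
  have h4 : Tendsto (fun n : ℕ => g x * (2 * (n : ℝ) + 1)⁻¹) atTop (𝓝 (g x * 0)) :=
    tendsto_const_nhds.mul (tendsto_inv_atTop_zero.comp
        (tendsto_atTop_add_const_right _ _ (hn.const_mul_atTop two_pos)))
  have h5 := (((h1.comp (tendsto_add_atTop_nat 1)).add
    (h2.comp (tendsto_add_atTop_nat 1))).mul h3).sub h4
  have h6 : (∫ x, g x ∂μ + ∫ x, g x ∂μ) * (1 / 2) - g x * 0 = ∫ x, g x ∂μ := by ring
  rw [h6] at h5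
  refine h5.congr fun n => ?_
  simp only [Function.comp, key, Nat.cast_add, Nat.cast_one]
  field_simp

end Birkhoff

/-! ### Unitarity of the block sums and of the extended pCMV operator -/

namespace PCMV

theorem delta_apply (k n : ℤ) : delta k n = if n = k then 1 else 0 := by
  rw [delta, lp.single_apply]
  by_cases h : n = k
  · subst h; simp
  · simp [h]

theorem inner_delta_left (k : ℤ) (u : HilbertZ) : inner ℂ (delta k) u = u k := by
  rw [delta, lp.inner_single_left]
  simp

theorem norm_delta (k : ℤ) : ‖delta k‖ = 1 := by
  rw [delta, lp.norm_single (by norm_num)]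
  simp

theorem norm_apply_le (u : HilbertZ) (k : ℤ) : ‖u k‖ ≤ ‖u‖ :=
  lp.norm_apply_le_norm (by norm_num) u k

theorem clm_ext {A B : HilbertZ →L[ℂ] HilbertZ} (h : ∀ k, A (delta k) = B (delta k)) : A = B := by
  refine lp.ext_continuousLinearMap (by norm_num) fun i => ?_
  exact ContinuousLinearMap.ext_ring (h i)

/-- Complex conjugation on the open unit disk. -/
def conjDisk (a : Disk) : Disk := ⟨conj (a : ℂ), by
  simpa using mem_ball_zero_iff.mp a.2⟩

/-- Complex conjugation on the unit circle. -/
def conjCircle (l : UCircle) : UCircle := ⟨conj (l : ℂ), by simp⟩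

@[simp] theorem coe_conjDisk (a : Disk) : (conjDisk a : ℂ) = conj (a : ℂ) := rfl

@[simp] theorem coe_conjCircle (l : UCircle) : (conjCircle l : ℂ) = conj (l : ℂ) := rfl

@[simp] theorem conjDisk_conjDisk (a : Disk) : conjDisk (conjDisk a) = a :=
  Subtype.ext (Complex.conj_conj _)

@[simp] theorem conjCircle_conjCircle (l : UCircle) : conjCircle (conjCircle l) = l :=
  Subtype.ext (Complex.conj_conj _)

@[simp] theorem rho_conjDisk (a : Disk) : rho (conjDisk a) = rho a := by simp [rho]

theorem rho_sq (a : Disk) : rho a ^ 2 = 1 - ‖(a : ℂ)‖ ^ 2 := by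
  have h : ‖(a : ℂ)‖ < 1 := mem_ball_zero_iff.mp a.2
  exact Real.sq_sqrt (by nlinarith [norm_nonneg (a : ℂ)])

theorem rho_pos (a : Disk) : 0 < rho a := by
  have h : ‖(a : ℂ)‖ < 1 := mem_ball_zero_iff.mp a.2
  exact Real.sqrt_pos.mpr (by nlinarith [norm_nonneg (a : ℂ)])

theorem rho_mul_self_add (a : Disk) : (rho a : ℂ) * rho a + a * conj (a : ℂ) = 1 := by
  rw [Complex.mul_conj, Complex.normSq_eq_norm_sq, ← Complex.ofReal_mul, ← Complex.ofReal_add,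
    ← pow_two, rho_sq]
  simp

theorem circle_mul_conj (l : UCircle) : (l : ℂ) * conj (l : ℂ) = 1 := by
  rw [Complex.mul_conj, Complex.normSq_eq_norm_sq, mem_sphere_zero_iff_norm.mp l.2]
  simp

theorem thetaFun_of_even (a : ℤ → Disk) (l : ℤ → UCircle) {s n : ℤ} (u : ℤ → ℂ)
    (h : Even (n - s)) :
    thetaFun a l s u n = l n * (conj (a n : ℂ) * u n + rho (a n) * u (n + 1)) := by
  simp [thetaFun, h, Theta]
  ring

theorem thetaFun_of_not_even (a : ℤ → Disk) (l : ℤ → UCircle) {s n : ℤ} (u : ℤ → ℂ)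
    (h : ¬ Even (n - s)) :
    thetaFun a l s u n =
      l (n - 1) * (rho (a (n - 1)) * u (n - 1) - (a (n - 1) : ℂ) * u n) := by
  simp [thetaFun, h, Theta]
  ring

/-- Each Θ is unitary and symmetric, so its inverse is its entrywise conjugate, which is again a Θ,
with conjugated parameters. This keeps adjoints inside the same family. -/
theorem thetaFun_conj_cancel (a : ℤ → Disk) (l : ℤ → UCircle) (s : ℤ) (u : ℤ → ℂ) (n : ℤ) :
    thetaFun a l s (thetaFun (fun n => conjDisk (a n)) (fun n => conjCircle (l n)) s u) n =
      u n := by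
  by_cases h : Even (n - s)
  · have h1 : ¬ Even (n + 1 - s) := by grind
    have e1 := circle_mul_conj (l n)
    have e2 := rho_mul_self_add (a n)
    rw [thetaFun_of_even _ _ _ h, thetaFun_of_even _ _ _ h, thetaFun_of_not_even _ _ _ h1]
    simp only [add_sub_cancel_right, coe_conjDisk, coe_conjCircle, rho_conjDisk, Complex.conj_conj]
    linear_combination (u n * (rho (a n) * rho (a n) + a n * conj (a n : ℂ))) * e1 + u n * e2
  · have h1 : Even (n - 1 - s) := by grind
    have e1 := circle_mul_conj (l (n - 1))
    have e2 := rho_mul_self_add (a (n - 1))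
    rw [thetaFun_of_not_even _ _ _ h, thetaFun_of_not_even _ _ _ h, thetaFun_of_even _ _ _ h1]
    simp only [sub_add_cancel, coe_conjDisk, coe_conjCircle, rho_conjDisk, Complex.conj_conj]
    linear_combination
      (u n * (rho (a (n - 1)) * rho (a (n - 1)) + a (n - 1) * conj (a (n - 1) : ℂ))) * e1 + u n * e2

theorem thetaSum_apply (a : ℤ → Disk) (l : ℤ → UCircle) (s : ℤ) (u : HilbertZ) (n : ℤ) :
    thetaSum a l s u n = thetaFun a l s u n := rfl

theorem thetaSum_conj_cancel (a : ℤ → Disk) (l : ℤ → UCircle) (s : ℤ) :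
    thetaSum a l s * thetaSum (fun n => conjDisk (a n)) (fun n => conjCircle (l n)) s = 1 := by
  ext u n
  exact thetaFun_conj_cancel a l s u n

theorem conj_thetaFun_delta (a : ℤ → Disk) (l : ℤ → UCircle) (s i j : ℤ) :
    conj (thetaFun a l s (delta j) i) =
      thetaFun (fun n => conjDisk (a n)) (fun n => conjCircle (l n)) s (delta j) i := by
  by_cases h : Even (i - s)
  · rw [thetaFun_of_even _ _ _ h, thetaFun_of_even _ _ _ h]
    simp [delta_apply, apply_ite (starRingEnd ℂ)]
  · rw [thetaFun_of_not_even _ _ _ h, thetaFun_of_not_even _ _ _ h]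
    simp [delta_apply, apply_ite (starRingEnd ℂ)]

theorem thetaFun_delta_comm (a : ℤ → Disk) (l : ℤ → UCircle) (s i j : ℤ) :
    thetaFun a l s (delta j) i = thetaFun a l s (delta i) j := by
  by_cases hi : Even (i - s) <;> by_cases hj : Even (j - s)
  · rw [thetaFun_of_even _ _ _ hi, thetaFun_of_even _ _ _ hj]
    simp only [delta_apply]
    by_cases h : i = j
    · subst h; rfl
    · have h1 : ¬ (i + 1 = j) := by grind
      have h2 : ¬ (j + 1 = i) := by grind
      simp [h, h1, h2, Ne.symm h]
  · rw [thetaFun_of_even _ _ _ hi, thetaFun_of_not_even _ _ _ hj]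
    simp only [delta_apply]
    have h : ¬ i = j := by grind
    by_cases h1 : i + 1 = j
    · subst h1; simp
    · have h2 : ¬ (j - 1 = i) := by omega
      simp [h, h1, h2, Ne.symm h]
  · rw [thetaFun_of_not_even _ _ _ hi, thetaFun_of_even _ _ _ hj]
    simp only [delta_apply]
    have h : ¬ i = j := by grind
    by_cases h1 : j + 1 = i
    · subst h1; simp
    · have h2 : ¬ (i - 1 = j) := by omega
      simp [h, h1, h2, Ne.symm h]
  · rw [thetaFun_of_not_even _ _ _ hi, thetaFun_of_not_even _ _ _ hj]
    simp only [delta_apply]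
    by_cases h : i = j
    · subst h; rfl
    · have h1 : ¬ (i - 1 = j) := by grind
      have h2 : ¬ (j - 1 = i) := by grind
      simp [h, h1, h2, Ne.symm h]

theorem star_thetaSum (a : ℤ → Disk) (l : ℤ → UCircle) (s : ℤ) :
    star (thetaSum a l s) =
      thetaSum (fun n => conjDisk (a n)) (fun n => conjCircle (l n)) s := by
  refine clm_ext fun i => ?_
  ext j
  rw [thetaSum_apply, ← conj_thetaFun_delta, thetaFun_delta_comm, ← thetaSum_apply,
    ← inner_delta_left, ← inner_delta_left, inner_conj_symm, ContinuousLinearMap.star_eq_adjoint,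
    ContinuousLinearMap.adjoint_inner_right]

theorem thetaSum_mem_unitary (a : ℤ → Disk) (l : ℤ → UCircle) (s : ℤ) :
    thetaSum a l s ∈ unitary (HilbertZ →L[ℂ] HilbertZ) := by
  rw [Unitary.mem_iff, star_thetaSum]
  refine ⟨?_, thetaSum_conj_cancel a l s⟩
  simpa using thetaSum_conj_cancel (fun n => conjDisk (a n)) (fun n => conjCircle (l n)) s

theorem pCMV_mem_unitary (a : ℤ → Disk) (l : ℤ → UCircle) :
    pCMV a l ∈ unitary (HilbertZ →L[ℂ] HilbertZ) :=
  mul_mem (thetaSum_mem_unitary a l 0) (thetaSum_mem_unitary a l 1)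

theorem norm_apply_of_mem_unitary {T : HilbertZ →L[ℂ] HilbertZ}
    (hT : T ∈ unitary (HilbertZ →L[ℂ] HilbertZ)) (u : HilbertZ) : ‖T u‖ = ‖u‖ :=
  ContinuousLinearMap.norm_map_of_mem_unitary hT u

/-! ### Pair traces and their covariance under the shift -/

/-- The trace of the compression of `A` to the span of `δ_k` and `δ_{k+1}`. -/
def pairTrace (A : HilbertZ →L[ℂ] HilbertZ) (k : ℤ) : ℂ :=
  A (delta k) k + A (delta (k + 1)) (k + 1)

theorem thetaSum_delta (a : ℤ → Disk) (l : ℤ → UCircle) {s k : ℤ} (h : Even (k - s)) :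
    thetaSum a l s (delta k) =
      (l k * conj (a k : ℂ)) • delta k + (l k * rho (a k) : ℂ) • delta (k + 1) := by
  ext n
  rw [thetaSum_apply, thetaFun_delta_comm, thetaFun_of_even _ _ _ h]
  simp only [lp.coeFn_add, lp.coeFn_smul, Pi.add_apply, Pi.smul_apply, smul_eq_mul, delta_apply]
  by_cases h1 : n = k
  · subst h1; simp
  · by_cases h2 : n = k + 1
    · subst h2; simp
    · simp [h1, h2, Ne.symm h1, Ne.symm h2]

theorem thetaSum_delta_succ (a : ℤ → Disk) (l : ℤ → UCircle) {s k : ℤ} (h : Even (k - s)) :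
    thetaSum a l s (delta (k + 1)) =
      (l k * rho (a k) : ℂ) • delta k + (-(l k * a k) : ℂ) • delta (k + 1) := by
  have h' : ¬ Even (k + 1 - s) := by grind
  ext n
  rw [thetaSum_apply, thetaFun_delta_comm, thetaFun_of_not_even _ _ _ h']
  simp only [lp.coeFn_add, lp.coeFn_smul, Pi.add_apply, Pi.smul_apply, smul_eq_mul, delta_apply]
  by_cases h1 : n = k
  · subst h1; simp
  · by_cases h2 : n = k + 1
    · subst h2; simp
    · simp [h1, h2, Ne.symm h1, Ne.symm h2]

/-- When k has the parity of s, the span of δ_k and δ_{k+1} reduces the block sum, and the trace of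
a 2 × 2 compression is invariant under a unitary of that plane. -/
theorem pairTrace_conjugate (a : ℤ → Disk) (l : ℤ → UCircle) {s k : ℤ} (h : Even (k - s))
    (A : HilbertZ →L[ℂ] HilbertZ) :
    pairTrace (star (thetaSum a l s) * A * thetaSum a l s) k = pairTrace A k := by
  have e1 := circle_mul_conj (l k)
  have e2 := rho_mul_self_add (a k)
  simp only [pairTrace, ← inner_delta_left]
  simp only [mul_apply_eq_comp, ContinuousLinearMap.star_eq_adjoint,
    ContinuousLinearMap.adjoint_inner_right, thetaSum_delta a l h, thetaSum_delta_succ a l h,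
    map_add, map_smul, inner_add_left, inner_add_right, inner_smul_left, inner_smul_right,
    map_mul, map_neg, Complex.conj_conj, Complex.conj_ofReal]
  generalize inner ℂ (delta k) (A (delta k)) = x
  generalize inner ℂ (delta (k + 1)) (A (delta k)) = y
  generalize inner ℂ (delta k) (A (delta (k + 1))) = z
  generalize inner ℂ (delta (k + 1)) (A (delta (k + 1))) = w
  linear_combination
    ((rho (a k) * rho (a k) + a k * conj (a k : ℂ)) * (x + w)) * e1 + (x + w) * e2

theorem thetaFun_shift (a : ℤ → Disk) (l : ℤ → UCircle) (s : ℤ) {u v : ℤ → ℂ}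
    (h : ∀ n, v n = u (n + 1)) (n : ℤ) :
    thetaFun (fun n => a (n + 1)) (fun n => l (n + 1)) s v n = thetaFun a l (s + 1) u (n + 1) := by
  simp only [thetaFun, h, add_sub_add_right_eq_sub, sub_add_cancel, add_sub_cancel_right]

theorem thetaFun_add_two (a : ℤ → Disk) (l : ℤ → UCircle) (s : ℤ) (u : ℤ → ℂ) (n : ℤ) :
    thetaFun a l (s + 2) u n = thetaFun a l s u n := by
  have : Even (n - (s + 2)) ↔ Even (n - s) := by grind
  simp only [thetaFun, this]

/-- A shift by one site changes parity, so it turns 𝓛𝓜 into 𝓜𝓛. -/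
theorem pCMV_pow_shift (a : ℤ → Disk) (l : ℤ → UCircle) (m : ℕ) {u v : HilbertZ}
    (h : ∀ n, v n = u (n + 1)) (n : ℤ) :
    (pCMV (fun n => a (n + 1)) (fun n => l (n + 1)) ^ m) v n =
      ((opM a l * opL a l) ^ m) u (n + 1) := by
  induction m generalizing u v n with
  | zero => exact h n
  | succ m ih =>
    rw [pow_succ, pow_succ]
    refine ih (u := opM a l (opL a l u)) (fun n => ?_) n
    refine thetaFun_shift a l 0 (fun n => ?_) n
    exact (thetaFun_shift a l 1 h n).trans (thetaFun_add_two a l 0 u (n + 1))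

/-- After the shift 𝓜𝓛 has to be traded for 𝓛𝓜. Since 𝓜𝓛 = 𝓛*(𝓛𝓜)𝓛 = 𝓜(𝓛𝓜)𝓜*, one can conjugate by
whichever of 𝓛, 𝓜 has a block on the pair in question; which one depends on the parity of the pair.
-/
theorem pairTrace_pCMV_shift (a : ℤ → Disk) (l : ℤ → UCircle) (m : ℕ) (k : ℤ) :
    pairTrace (pCMV (fun n => a (n + 1)) (fun n => l (n + 1)) ^ m) k =
      pairTrace (pCMV a l ^ m) (k + 1) := by
  have hd : ∀ k n : ℤ, delta k n = delta (k + 1) (n + 1) := by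
    intro k n
    simp [delta_apply]
  have h1 : pairTrace (pCMV (fun n => a (n + 1)) (fun n => l (n + 1)) ^ m) k =
      pairTrace ((opM a l * opL a l) ^ m) (k + 1) := by
    simp only [pairTrace]
    rw [pCMV_pow_shift a l m (hd k), pCMV_pow_shift a l m (hd (k + 1))]
  have hL := thetaSum_mem_unitary a l 0
  have hM := thetaSum_mem_unitary a l 1
  rw [h1]
  by_cases hk : Even (k + 1)
  · rw [← pairTrace_conjugate a l (s := 0) (by simpa using hk) (pCMV a l ^ m)]
    congr 1
    have := (SemiconjBy.pow_right (show SemiconjBy (opL a l) (opM a l * opL a l) (pCMV a l) from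
      (mul_assoc _ _ _).symm) m)
    change _ = star (opL a l) * _ * opL a l
    rw [mul_assoc, ← this.eq, ← mul_assoc]
    change _ = star (thetaSum a l 0) * thetaSum a l 0 * _
    rw [Unitary.star_mul_self_of_mem hL, one_mul]
  · rw [← pairTrace_conjugate (fun n => conjDisk (a n)) (fun n => conjCircle (l n)) (s := 1)
      (by grind) (pCMV a l ^ m), ← star_thetaSum, star_star]
    congr 1
    have := (SemiconjBy.pow_right (show SemiconjBy (opM a l) (pCMV a l) (opM a l * opL a l) from
      (mul_assoc _ _ _).symm) m)
    change _ = opM a l * _ * star (opM a l)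
    rw [this.eq, mul_assoc]
    change _ = _ * (thetaSum a l 1 * star (thetaSum a l 1))
    rw [Unitary.mul_star_self_of_mem hM, mul_one]

theorem pairTrace_pCMV_add (a : ℤ → Disk) (l : ℤ → UCircle) (m : ℕ) (j k : ℤ) :
    pairTrace (pCMV (fun n => a (n + j)) (fun n => l (n + j)) ^ m) k =
      pairTrace (pCMV a l ^ m) (k + j) := by
  -- An equivalence, so that it serves both directions of the induction on integers.
  have step : ∀ j : ℤ, (∀ k, pairTrace (pCMV (fun n => a (n + j)) (fun n => l (n + j)) ^ m) k =
      pairTrace (pCMV a l ^ m) (k + j)) ↔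
      ∀ k, pairTrace (pCMV (fun n => a (n + (j + 1))) (fun n => l (n + (j + 1))) ^ m) k =
      pairTrace (pCMV a l ^ m) (k + (j + 1)) := by
    intro j
    have h := pairTrace_pCMV_shift (fun n => a (n + j)) (fun n => l (n + j)) m
    simp only [add_right_comm _ (1 : ℤ) j, add_assoc _ j 1] at h
    constructor
    · intro H k
      rw [h, H]
      congr 1; ring
    · intro H k
      have := h (k - 1)
      rw [sub_add_cancel] at this
      rw [← this, H]
      congr 1; ring
  revert k
  induction j using Int.induction_on with
  | zero => simp
  | succ i ih => exact (step _).mp ih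
  | pred i ih =>
    refine (step _).mpr ?_
    simpa using ih

/-! ### Stationarity and measurability along the orbit -/

section Dynamics

variable {Ω : Type*} [MeasurableSpace Ω] (S : Ω ≃ᵐ Ω) (f : Ω → Disk) (g : Ω → UCircle)

theorem dynPCMV_mem_unitary (ω : Ω) :
    dynPCMV S f g ω ∈ unitary (HilbertZ →L[ℂ] HilbertZ) := pCMV_mem_unitary _ _

theorem pairTrace_dynPCMV (m : ℕ) (k : ℤ) (ω : Ω) :
    pairTrace (dynPCMV S f g ω ^ m) k =
      pairTrace (dynPCMV S f g ((S.toEquiv ^ k : Equiv.Perm Ω) ω) ^ m) 0 := by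
  have h := pairTrace_pCMV_add (fun n => f ((S.toEquiv ^ n : Equiv.Perm Ω) ω))
    (fun n => g ((S.toEquiv ^ n : Equiv.Perm Ω) ω)) m k 0
  simp only [zpow_add, Equiv.Perm.mul_apply, zero_add] at h
  exact h.symm

variable {f g}

theorem measurable_zpow (n : ℤ) : Measurable fun ω => (S.toEquiv ^ n : Equiv.Perm Ω) ω := by
  cases n with
  | ofNat n =>
    simp only [Int.ofNat_eq_natCast, zpow_natCast, Equiv.Perm.coe_pow]
    exact S.measurable.iterate n
  | negSucc n =>
    simp only [zpow_negSucc, ← inv_pow, Equiv.Perm.coe_pow]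
    exact S.symm.measurable.iterate _

theorem measurable_rho_comp {a : Ω → Disk} (ha : Measurable a) :
    Measurable fun ω => rho (a ω) := by
  have : Measurable fun ω => (a ω : ℂ) := measurable_subtype_coe.comp ha
  unfold rho
  fun_prop

theorem measurable_thetaFun {a : Ω → ℤ → Disk} {l : Ω → ℤ → UCircle}
    (ha : ∀ n, Measurable fun ω => a ω n) (hl : ∀ n, Measurable fun ω => l ω n) (s : ℤ)
    {u : Ω → ℤ → ℂ} (hu : ∀ n, Measurable fun ω => u ω n) (n : ℤ) :
    Measurable fun ω => thetaFun (a ω) (l ω) s (u ω) n := by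
  have ha' : ∀ n, Measurable fun ω => (a ω n : ℂ) := fun n => measurable_subtype_coe.comp (ha n)
  have hl' : ∀ n, Measurable fun ω => (l ω n : ℂ) := fun n => measurable_subtype_coe.comp (hl n)
  have hr : ∀ n, Measurable fun ω => (rho (a ω n) : ℂ) := fun n =>
    Complex.measurable_ofReal.comp (measurable_rho_comp (ha n))
  by_cases h : Even (n - s)
  · simp only [fun ω => thetaFun_of_even (a ω) (l ω) (u ω) h]
    exact (hl' n).mul (((Complex.continuous_conj.measurable.comp (ha' n)).mul (hu n)).add
      ((hr n).mul (hu (n + 1))))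
  · simp only [fun ω => thetaFun_of_not_even (a ω) (l ω) (u ω) h]
    exact (hl' (n - 1)).mul (((hr (n - 1)).mul (hu (n - 1))).sub ((ha' (n - 1)).mul (hu n)))

theorem measurable_dynPCMV_pow_delta (hf : Measurable f) (hg : Measurable g) (m : ℕ) (k n : ℤ) :
    Measurable fun ω => (dynPCMV S f g ω ^ m) (delta k) n := by
  induction m generalizing n with
  | zero => exact measurable_const
  | succ m ih =>
    simp only [pow_succ']
    have ha : ∀ n : ℤ, Measurable fun ω => f ((S.toEquiv ^ n : Equiv.Perm Ω) ω) := fun n =>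
      hf.comp (measurable_zpow S n)
    have hl : ∀ n : ℤ, Measurable fun ω => g ((S.toEquiv ^ n : Equiv.Perm Ω) ω) := fun n =>
      hg.comp (measurable_zpow S n)
    exact measurable_thetaFun ha hl 0 (measurable_thetaFun ha hl 1 ih) n

theorem measurable_pairTrace (hf : Measurable f) (hg : Measurable g) (m : ℕ) (k : ℤ) :
    Measurable fun ω => pairTrace (dynPCMV S f g ω ^ m) k :=
  (measurable_dynPCMV_pow_delta S hf hg m k k).add
    (measurable_dynPCMV_pow_delta S hf hg m (k + 1) (k + 1))

theorem norm_diag_pow_le {E : HilbertZ →L[ℂ] HilbertZ}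
    (hE : E ∈ unitary (HilbertZ →L[ℂ] HilbertZ)) (m : ℕ) (k : ℤ) :
    ‖(E ^ m) (delta k) k‖ ≤ 1 := by
  refine (norm_apply_le _ k).trans ?_
  rw [norm_apply_of_mem_unitary (pow_mem hE m), norm_delta]

theorem norm_pairTrace_le {E : HilbertZ →L[ℂ] HilbertZ}
    (hE : E ∈ unitary (HilbertZ →L[ℂ] HilbertZ)) (m : ℕ) (k : ℤ) :
    ‖pairTrace (E ^ m) k‖ ≤ 2 := by
  refine (norm_add_le _ _).trans ?_
  linarith [norm_diag_pow_le hE m k, norm_diag_pow_le hE m (k + 1)]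

end Dynamics

end PCMV

/-! ### Lower bound for the characteristic polynomial of the Dirichlet restriction -/

namespace PCMV

open Matrix

theorem thetaFun_congr (a : ℤ → Disk) (l : ℤ → UCircle) {s t : ℤ} (h : Even (s - t)) (u : ℤ → ℂ)
    (n : ℤ) : thetaFun a l s u n = thetaFun a l t u n := by
  have : Even (n - s) ↔ Even (n - t) := by grind
  simp only [thetaFun, this]

/-- The site of the window `[-n, n+1]` with index `i`. -/
def site (n : ℕ) (i : Fin (2 * n + 1 + 1)) : ℤ := (i : ℤ) - n

theorem delta_site (n : ℕ) (i j : Fin (2 * n + 1 + 1)) :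
    delta (site n j) (site n i) = if i = j then 1 else 0 := by
  rw [delta_apply]
  have : site n i = site n j ↔ i = j := by
    simp only [site, sub_left_inj, Nat.cast_inj, Fin.val_inj]
  simp only [this]

theorem site_last (n : ℕ) : site n (Fin.last _) = n + 1 := by
  simp only [site, Fin.val_last]; push_cast; ring

/-- The direct sum of the blocks `Θ` that fill the window `[-n, n+1]`. -/
def blockMatrix (a : ℤ → Disk) (l : ℤ → UCircle) (n : ℕ) :
    Matrix (Fin (2 * n + 1 + 1)) (Fin (2 * n + 1 + 1)) ℂ :=
  fun i j => thetaFun a l (-n) (delta (site n j)) (site n i)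

/-- The compression to `[-n, n]` of the direct sum of the blocks `Θ` of the other parity, extended
by zero to `[-n, n+1]`. -/
def cutMatrix (a : ℤ → Disk) (l : ℤ → UCircle) (n : ℕ) :
    Matrix (Fin (2 * n + 1 + 1)) (Fin (2 * n + 1 + 1)) ℂ :=
  fun i j => if i = Fin.last _ then 0 else thetaFun a l (-n + 1) (delta (site n j)) (site n i)

variable (a : ℤ → Disk) (l : ℤ → UCircle) (n : ℕ)

/-- The window [-n, n+1] starts where a block starts and has even length, so no block is cut and
values outside do not enter. This is what makes `blockMatrix` unitary. -/
theorem blockMatrix_mulVec (v : ℤ → ℂ) (i : Fin (2 * n + 1 + 1)) :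
    (blockMatrix a l n *ᵥ fun j => v (site n j)) i = thetaFun a l (-n) v (site n i) := by
  change ∑ j, thetaFun a l (-n) (delta (site n j)) (site n i) * v (site n j) = _
  by_cases h : Even (site n i - -n)
  · have h0 : Even (i : ℕ) := by simpa [site] using h
    have hi := i.2
    have h1 : site n i + 1 = site n ⟨i + 1, by grind⟩ := by
      simp only [site]; push_cast; ring
    simp only [thetaFun_of_even _ _ _ h, h1, delta_site, mul_add, add_mul,
      Finset.sum_add_distrib, mul_ite, ite_mul, mul_one, mul_zero, zero_mul, Finset.sum_ite_eq,
      Finset.mem_univ, if_true, mul_assoc]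
  · have h0 : ¬ Even (i : ℕ) := by simpa [site] using h
    have hi := i.2
    have h1 : site n i - 1 = site n ⟨i - 1, by grind⟩ := by
      have : 1 ≤ (i : ℕ) := by grind
      simp only [site]; push_cast [this]; ring
    rw [thetaFun_of_not_even _ _ _ h]
    simp only [thetaFun_of_not_even _ _ _ h, h1, delta_site, mul_sub, sub_mul,
      Finset.sum_sub_distrib, mul_ite, ite_mul, mul_one, mul_zero, zero_mul, Finset.sum_ite_eq,
      Finset.mem_univ, if_true, mul_assoc]

theorem blockMatrix_mul_conjTranspose : blockMatrix a l n * (blockMatrix a l n)ᴴ = 1 := by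
  ext i k
  have h := blockMatrix_mulVec a l n
    (thetaFun (fun n => conjDisk (a n)) (fun n => conjCircle (l n)) (-n) (delta (site n k))) i
  rw [thetaFun_conj_cancel, delta_site] at h
  rw [Matrix.one_apply, ← h, Matrix.mul_apply]
  refine Finset.sum_congr rfl fun j _ => ?_
  change thetaFun a l (-n) (delta (site n j)) (site n i) *
    conj (thetaFun a l (-n) (delta (site n j)) (site n k)) = _
  rw [conj_thetaFun_delta, thetaFun_delta_comm _ _ _ (site n k)]
  rfl

theorem norm_det_blockMatrix : ‖(blockMatrix a l n).det‖ = 1 := by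
  have h := congrArg Matrix.det (blockMatrix_mul_conjTranspose a l n)
  rw [Matrix.det_mul, Matrix.det_conjTranspose, Matrix.det_one, Complex.star_def,
    Complex.mul_conj, Complex.normSq_eq_norm_sq] at h
  have h2 : ‖(blockMatrix a l n).det‖ ^ 2 = 1 := by exact_mod_cast h
  exact (pow_eq_one_iff_of_nonneg (norm_nonneg _) two_ne_zero).mp h2

theorem star_dotProduct_self {ι : Type*} [Fintype ι] (u : ι → ℂ) :
    star u ⬝ᵥ u = ((∑ i, ‖u i‖ ^ 2 : ℝ) : ℂ) := by
  simp only [dotProduct, Pi.star_apply, Complex.star_def, mul_comm (conj _), Complex.mul_conj,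
    Complex.normSq_eq_norm_sq]
  push_cast
  rfl

theorem sum_norm_sq_conjTranspose_mulVec {ι : Type*} [Fintype ι] [DecidableEq ι]
    {L : Matrix ι ι ℂ} (hL : L * Lᴴ = 1) (u : ι → ℂ) :
    ∑ i, ‖(Lᴴ *ᵥ u) i‖ ^ 2 = ∑ i, ‖u i‖ ^ 2 := by
  have h : star (Lᴴ *ᵥ u) ⬝ᵥ (Lᴴ *ᵥ u) = star u ⬝ᵥ u := by
    rw [Matrix.star_mulVec, Matrix.conjTranspose_conjTranspose, ← Matrix.dotProduct_mulVec,
      Matrix.mulVec_mulVec, hL, Matrix.one_mulVec]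
  rw [star_dotProduct_self, star_dotProduct_self] at h
  exact_mod_cast h

/-- The finitely supported sequence with the values `u` at the points `x`. -/
def embed {ι : Type*} [Fintype ι] (x : ι → ℤ) (u : ι → ℂ) : HilbertZ := ∑ j, u j • delta (x j)

theorem embed_apply {ι : Type*} [Fintype ι] (x : ι → ℤ) (u : ι → ℂ) (k : ℤ) :
    embed x u k = ∑ j, u j * delta (x j) k := by
  rw [embed, lp.coeFn_sum, Finset.sum_apply]
  rfl

theorem embed_apply_self {ι : Type*} [Fintype ι] {x : ι → ℤ} (hx : Function.Injective x)
    (u : ι → ℂ) (i : ι) : embed x u (x i) = u i := by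
  classical
  simp [embed_apply, delta_apply, hx.eq_iff]

theorem embed_apply_of_notMem {ι : Type*} [Fintype ι] {x : ι → ℤ} (u : ι → ℂ) {k : ℤ}
    (hk : ∀ i, k ≠ x i) : embed x u k = 0 := by
  simp [embed_apply, delta_apply, hk]

theorem norm_embed_sq {ι : Type*} [Fintype ι] {x : ι → ℤ} (hx : Function.Injective x)
    (u : ι → ℂ) : ‖embed x u‖ ^ 2 = ∑ i, ‖u i‖ ^ 2 := by
  refine (hasSum_sq _).unique ?_
  have h : HasSum (fun k => ‖embed x u k‖ ^ 2)
      (∑ k ∈ Finset.univ.map ⟨x, hx⟩, ‖embed x u k‖ ^ 2) :=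
    hasSum_sum_of_ne_finset_zero fun k hk => by
      rw [embed_apply_of_notMem u fun i hi => hk (by simp [hi])]
      simp
  simpa [embed_apply_self hx] using h

theorem sum_norm_sq_le_norm_sq {ι : Type*} [Fintype ι] {x : ι → ℤ} (hx : Function.Injective x)
    (v : HilbertZ) : ∑ i, ‖v (x i)‖ ^ 2 ≤ ‖v‖ ^ 2 := by
  have h : ∑ k ∈ Finset.univ.map ⟨x, hx⟩, ‖v k‖ ^ 2 ≤ ‖v‖ ^ 2 :=
    sum_le_hasSum _ (fun _ _ => sq_nonneg _) (hasSum_sq v)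
  simpa using h

theorem site_injective : Function.Injective (site n) := fun i j h => by
  simpa only [site, sub_left_inj, Nat.cast_inj, Fin.val_inj] using h

theorem cutMatrix_mulVec (u : Fin (2 * n + 1 + 1) → ℂ) (i : Fin (2 * n + 1 + 1)) :
    (cutMatrix a l n *ᵥ u) i =
      if i = Fin.last _ then 0 else thetaSum a l (-n + 1) (embed (site n) u) (site n i) := by
  change ∑ j, cutMatrix a l n i j * u j = _
  simp only [cutMatrix]
  split_ifs with h
  · simp
  · rw [embed, map_sum, lp.coeFn_sum, Finset.sum_apply]
    refine Finset.sum_congr rfl fun j _ => ?_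
    rw [map_smul, lp.coeFn_smul, Pi.smul_apply, smul_eq_mul, mul_comm]
    rfl

/-- The full block sum is isometric, and the block on {-n-1, -n} sends exactly ρ_{-n-1} u_0 to the
site -n-1, which lies outside the window. That mass is lost in the compression. -/
theorem sum_norm_sq_cutMatrix_le (u : Fin (2 * n + 1 + 1) → ℂ) :
    ∑ i, ‖(cutMatrix a l n *ᵥ u) i‖ ^ 2 + (rho (a (-n - 1)) * ‖u 0‖) ^ 2 ≤ ∑ i, ‖u i‖ ^ 2 := by
  set w := thetaSum a l (-n + 1) (embed (site n) u) with hw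
  have hnorm : ∑ i, ‖u i‖ ^ 2 = ‖w‖ ^ 2 := by
    rw [hw, norm_apply_of_mem_unitary (thetaSum_mem_unitary a l (-n + 1)),
      norm_embed_sq (site_injective n)]
  rw [hnorm]
  have hx : Function.Injective fun o : Option (Fin (2 * n + 1 + 1)) =>
      o.elim (-(n : ℤ) - 1) (site n) := by
    rw [Option.injective_iff]
    refine ⟨site_injective n, ?_⟩
    rintro ⟨i, hi⟩
    simp only [Function.comp, Option.elim, site] at hi
    omega
  have h := sum_norm_sq_le_norm_sq hx w
  rw [Fintype.sum_option] at h
  simp only [Option.elim] at h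
  have h0 : ‖w (-(n : ℤ) - 1)‖ = rho (a (-n - 1)) * ‖u 0‖ := by
    have he : Even (-(n : ℤ) - 1 - (-n + 1)) := by
      rw [show -(n : ℤ) - 1 - (-n + 1) = -2 by ring]; decide
    have hs : -(n : ℤ) - 1 + 1 = site n 0 := by simp [site]
    rw [hw, thetaSum_apply, thetaFun_of_even _ _ _ he, hs, embed_apply_self (site_injective n),
      embed_apply_of_notMem]
    · simp [mem_sphere_zero_iff_norm.mp (l (-n - 1)).2, abs_of_pos (rho_pos _)]
    · intro i hi
      simp only [site] at hi
      omega
  rw [h0] at h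
  refine le_trans ?_ h
  rw [add_comm]
  gcongr with i
  rw [cutMatrix_mulVec]
  split_ifs
  · simp
  · exact le_rfl

theorem thetaFun_delta_eq_zero {s i j : ℤ} (h : 1 < |i - j|) :
    thetaFun a l s (delta j) i = 0 := by
  rw [lt_abs] at h
  have h0 : ¬ i = j := by omega
  have h1 : ¬ i + 1 = j := by omega
  have h2 : ¬ i - 1 = j := by omega
  simp [thetaFun, delta_apply, h0, h1, h2]

/-- The tridiagonal matrix `z 𝓛* - 𝓜` on the window `[-n, n+1]`. -/
def pencil (z : ℂ) : Matrix (Fin (2 * n + 1 + 1)) (Fin (2 * n + 1 + 1)) ℂ :=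
  z • (blockMatrix a l n)ᴴ - cutMatrix a l n

theorem pencil_apply (z : ℂ) (i j : Fin (2 * n + 1 + 1)) :
    pencil a l n z i j = z * conj (blockMatrix a l n j i) - cutMatrix a l n i j := rfl

/-- Two neighbouring sites share a block of exactly one parity, so only one of the two terms
contributes, with modulus |z| ρ or ρ. -/
theorem rho_le_norm_pencil {z : ℂ} (hz : 1 ≤ ‖z‖) (i : Fin (2 * n + 1)) :
    rho (a (site n i.castSucc)) ≤ ‖pencil a l n z i.castSucc i.succ‖ := by
  have hne : i.castSucc ≠ Fin.last _ := (Fin.castSucc_lt_last i).ne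
  have hsucc : site n i.succ = site n i.castSucc + 1 := by
    simp only [site, Fin.val_succ, Fin.val_castSucc]; push_cast; ring
  have hl : ‖(l (site n i.castSucc) : ℂ)‖ = 1 := mem_sphere_zero_iff_norm.mp (l _).2
  have hr := rho_pos (a (site n i.castSucc))
  rw [pencil_apply, cutMatrix, if_neg hne, blockMatrix, hsucc, thetaFun_delta_comm]
  by_cases h : Even (site n i.castSucc - -n)
  · have h' : ¬ Even (site n i.castSucc - (-n + 1)) := by grind
    rw [thetaFun_of_even _ _ _ h, thetaFun_of_not_even _ _ _ h']
    have h1 : ¬ (site n i.castSucc - 1 = site n i.castSucc + 1) := by omega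
    simp only [delta_apply, h1, if_true, if_false, left_eq_add, one_ne_zero, mul_zero, zero_add,
      mul_one, sub_zero, norm_mul, RCLike.norm_conj, hl, one_mul, Complex.norm_real,
      Real.norm_eq_abs, abs_of_pos hr]
    nlinarith
  · have h' : Even (site n i.castSucc - (-n + 1)) := by grind
    rw [thetaFun_of_not_even _ _ _ h, thetaFun_of_even _ _ _ h']
    have h1 : ¬ (site n i.castSucc - 1 = site n i.castSucc + 1) := by omega
    simp only [delta_apply, h1, if_true, if_false, left_eq_add, one_ne_zero, mul_zero, zero_add,
      mul_one, sub_zero, zero_sub, norm_neg, map_zero, norm_mul, hl, one_mul, Complex.norm_real,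
      Real.norm_eq_abs, abs_of_pos hr, le_refl]

/-- Deleting the last row and the first column of a tridiagonal matrix leaves a lower triangular one
with the old superdiagonal on its diagonal. -/
theorem prod_rho_le_norm_adjugate {z : ℂ} (hz : 1 ≤ ‖z‖) :
    ∏ i : Fin (2 * n + 1), rho (a (site n i.castSucc)) ≤
      ‖(pencil a l n z).adjugate 0 (Fin.last _)‖ := by
  rw [Matrix.adjugate_fin_succ_eq_det_submatrix, norm_mul, norm_pow, norm_neg, norm_one, one_pow,
    one_mul, Fin.succAbove_last, Matrix.det_of_isLowerTriangular, norm_prod]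
  · refine Finset.prod_le_prod (fun i _ => (rho_pos _).le) fun i _ => ?_
    rw [Matrix.submatrix_apply, Fin.succAbove_zero]
    exact rho_le_norm_pencil a l n hz i
  · intro i j hij
    have hij' : (i : ℕ) < j := by simpa using hij
    rw [Matrix.submatrix_apply, Fin.succAbove_zero, pencil_apply, cutMatrix, blockMatrix,
      thetaFun_delta_comm, thetaFun_delta_eq_zero, thetaFun_delta_eq_zero]
    · simp
    all_goals
      rw [lt_abs]
      simp only [site, Fin.val_castSucc, Fin.val_succ]
      push_cast
      omega

/-- Let B be the pencil, L the block matrix, C the cut matrix, and u the last column of adj B. Then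
Bu = det(B) e_last, that is zL*u = Cu + det(B) e_last. The last entry of Cu is 0, so |z|²‖u‖² =
‖Cu‖² + |det B|². With |z| ≥ 1 and the loss of mass in C, this gives |det B| ≥ ρ_{-n-1} |u_0|, and
u_0 is the corner entry of the adjugate. -/
theorem prod_rho_le_norm_det_pencil {z : ℂ} (hz : 1 ≤ ‖z‖) :
    rho (a (-n - 1)) * ∏ i : Fin (2 * n + 1), rho (a (site n i.castSucc)) ≤
      ‖(pencil a l n z).det‖ := by
  set B := pencil a l n z with hB
  set u : Fin (2 * n + 1 + 1) → ℂ := fun i => B.adjugate i (Fin.last _) with hu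
  have hBu : ∀ i, (B *ᵥ u) i = B.det * (if i = Fin.last _ then 1 else 0) := by
    intro i
    have := congrFun (congrFun B.mul_adjugate i) (Fin.last _)
    rw [Matrix.mul_apply] at this
    rw [Matrix.smul_apply, Matrix.one_apply, smul_eq_mul] at this
    exact this
  have hsplit : ∀ i, ‖z‖ ^ 2 * ‖((blockMatrix a l n)ᴴ *ᵥ u) i‖ ^ 2 =
      ‖(cutMatrix a l n *ᵥ u) i‖ ^ 2 + if i = Fin.last _ then ‖B.det‖ ^ 2 else 0 := by
    intro i
    have h1 : z * ((blockMatrix a l n)ᴴ *ᵥ u) i =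
        (cutMatrix a l n *ᵥ u) i + B.det * (if i = Fin.last _ then 1 else 0) := by
      rw [← hBu, hB, pencil, Matrix.sub_mulVec, Matrix.smul_mulVec]
      simp
    rw [← mul_pow, ← norm_mul, h1, cutMatrix_mulVec]
    split_ifs <;> simp
  have hsum := Finset.sum_congr rfl fun i (_ : i ∈ Finset.univ) => hsplit i
  rw [← Finset.mul_sum, sum_norm_sq_conjTranspose_mulVec (blockMatrix_mul_conjTranspose a l n),
    Finset.sum_add_distrib, Finset.sum_ite_eq' Finset.univ, if_pos (Finset.mem_univ _)] at hsum
  have hcut := sum_norm_sq_cutMatrix_le a l n u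
  have hz2 : 1 ≤ ‖z‖ ^ 2 := one_le_pow₀ hz
  have hu0 : 0 ≤ ∑ i, ‖u i‖ ^ 2 := Finset.sum_nonneg fun _ _ => sq_nonneg _
  have h1 : rho (a (-n - 1)) * ‖u 0‖ ≤ ‖B.det‖ := by
    refine le_of_sq_le_sq ?_ (norm_nonneg _)
    nlinarith
  refine le_trans ?_ h1
  exact mul_le_mul_of_nonneg_left (prod_rho_le_norm_adjugate a l n hz) (rho_pos _).le

/-- In the other parity the site n+1 is paired with n+2, so δ_{n+1} reaches only the row that has
been set to zero. -/
theorem cutMatrix_last (i : Fin (2 * n + 1 + 1)) : cutMatrix a l n i (Fin.last _) = 0 := by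
  rw [cutMatrix]
  split_ifs with h
  · rfl
  · have hi : (i : ℕ) < 2 * n + 1 := Fin.val_lt_last h
    rw [site_last]
    by_cases h1 : Even (site n i - (-n + 1))
    · rw [thetaFun_of_even _ _ _ h1]
      have h2 : ¬ (site n i = n + 1) := by simp only [site]; omega
      have h3 : ¬ (site n i + 1 = n + 1) := by simp only [site] at h1 ⊢; grind
      simp only [delta_apply, h2, h3, if_false, mul_zero, add_zero]
    · rw [thetaFun_of_not_even _ _ _ h1]
      have h2 : ¬ (site n i = n + 1) := by simp only [site]; omega
      have h3 : ¬ (site n i - 1 = n + 1) := by simp only [site]; omega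
      simp only [delta_apply, h2, h3, if_false, mul_zero, sub_zero]

/-- Zeroing the last row is harmless here: the block on {n+1, n+2} does not meet any δ_j with j ≤ n.
-/
theorem blockMatrix_mul_cutMatrix_apply (i j : Fin (2 * n + 1)) :
    (blockMatrix a l n * cutMatrix a l n) i.castSucc j.castSucc =
      thetaSum a l (-n) (thetaSum a l (-n + 1) (delta (site n j.castSucc))) (site n i.castSucc) := by
  rw [thetaSum_apply, ← blockMatrix_mulVec, Matrix.mul_apply]
  refine Finset.sum_congr rfl fun k _ => ?_
  congr 1
  rw [cutMatrix]
  split_ifs with h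
  · have he : Even (site n k - (-n + 1)) := by
      rw [h, site_last]; grind
    have h1 : ¬ (site n k = site n j.castSucc) := by
      rw [h, (site_injective n).eq_iff]
      exact (Fin.castSucc_lt_last j).ne'
    have h2 : ¬ (site n k + 1 = site n j.castSucc) := by
      rw [h, site_last]
      have := j.2
      simp only [site, Fin.val_castSucc]
      omega
    symm
    refine (thetaFun_of_even a l (delta (site n j.castSucc)) he).trans ?_
    simp only [delta_apply, h1, h2, if_false, mul_zero, add_zero]
  · rfl

/-- The indices of the window `[-n, n]`. -/
def siteEquiv : Fin (2 * n + 1) ≃ Finset.Icc (-(n : ℤ)) n where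
  toFun i := ⟨site n i.castSucc, by
    have := i.2
    simp only [site, Fin.val_castSucc, Finset.mem_Icc]
    omega⟩
  invFun p := ⟨(p.1 + n).toNat, by
    have := Finset.mem_Icc.mp p.2
    omega⟩
  left_inv i := by
    ext
    simp [site]
  right_inv p := by
    have := Finset.mem_Icc.mp p.2
    ext
    simp only [site, Fin.val_castSucc]
    omega

theorem pCMV_apply_comm (i j : ℤ) :
    opM a l (opL a l (delta j)) i = pCMV a l (delta i) j := by
  change _ = opL a l (opM a l (delta i)) j
  have key : ∀ (s : ℤ) (u v : HilbertZ), (∀ k, conj (v k) = u k) → ∀ k,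
      conj (star (thetaSum a l s) v k) = thetaSum a l s u k := by
    intro s u v h k
    rw [star_thetaSum, thetaSum_apply, thetaSum_apply]
    by_cases hk : Even (k - s)
    · rw [thetaFun_of_even _ _ _ hk, thetaFun_of_even _ _ _ hk]
      simp [← h]
    · rw [thetaFun_of_not_even _ _ _ hk, thetaFun_of_not_even _ _ _ hk]
      simp [← h]
  have hd : ∀ j k : ℤ, conj (delta j k) = delta j k := fun j k => by
    simp [delta_apply, apply_ite (starRingEnd ℂ)]
  rw [opM, opL, ← key 1 _ _ (key 0 _ _ (hd j)), ← inner_delta_left, inner_conj_symm,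
    ContinuousLinearMap.star_eq_adjoint, ContinuousLinearMap.star_eq_adjoint,
    ContinuousLinearMap.adjoint_inner_left, ContinuousLinearMap.adjoint_inner_left,
    inner_delta_left]

theorem thetaSum_congr {s t : ℤ} (h : Even (s - t)) : thetaSum a l s = thetaSum a l t := by
  ext u k
  exact thetaFun_congr a l h u k

/-- The blocks filling the window have the parity of n. For even n the product is 𝓛𝓜; for odd n it
is 𝓜𝓛, which is the transpose of 𝓛𝓜 because both factors are symmetric. -/
theorem det_scalar_sub_dirichletMatrix (z : ℂ) :
    (Matrix.scalar _ z - dirichletMatrix (pCMV a l) n).det =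
      ((z • 1 - blockMatrix a l n * cutMatrix a l n).submatrix
        Fin.castSucc Fin.castSucc).det := by
  rw [← Matrix.det_submatrix_equiv_self (siteEquiv n)]
  have hval : ∀ i, ((siteEquiv n i : Finset.Icc (-(n : ℤ)) n) : ℤ) = site n i.castSucc :=
    fun _ => rfl
  rcases Nat.even_or_odd n with hn | hn
  · congr 1
    ext i j
    simp only [Matrix.submatrix_apply, Matrix.sub_apply, blockMatrix_mul_cutMatrix_apply,
      dirichletMatrix, hval, inner_delta_left, Matrix.scalar_apply, Matrix.smul_apply,
      Matrix.one_apply, Matrix.diagonal_apply, smul_eq_mul, mul_ite, mul_one, mul_zero,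
      (siteEquiv n).injective.eq_iff, (Fin.castSucc_injective _).eq_iff]
    rw [thetaSum_congr a l (s := -n) (t := 0) (by grind),
      thetaSum_congr a l (s := -n + 1) (t := 1) (by grind)]
    rfl
  · rw [← Matrix.det_transpose]
    congr 1
    ext i j
    simp only [Matrix.transpose_apply, Matrix.submatrix_apply, Matrix.sub_apply,
      blockMatrix_mul_cutMatrix_apply,
      dirichletMatrix, hval, inner_delta_left, Matrix.scalar_apply, Matrix.smul_apply,
      Matrix.one_apply, Matrix.diagonal_apply, smul_eq_mul, mul_ite, mul_one, mul_zero,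
      (siteEquiv n).injective.eq_iff, (Fin.castSucc_injective _).eq_iff]
    rw [thetaSum_congr a l (s := -n) (t := 1) (by grind),
      thetaSum_congr a l (s := -n + 1) (t := 0) (by grind), ← pCMV_apply_comm]
    simp only [eq_comm (a := j)]
    rfl

theorem det_smul_one_sub_blockMatrix_mul_cutMatrix (z : ℂ) :
    (z • 1 - blockMatrix a l n * cutMatrix a l n).det =
      z * ((z • 1 - blockMatrix a l n * cutMatrix a l n).submatrix
        Fin.castSucc Fin.castSucc).det := by
  have hcol : ∀ i, (blockMatrix a l n * cutMatrix a l n) i (Fin.last _) = 0 := fun i => by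
    simp [Matrix.mul_apply, cutMatrix_last]
  rw [Matrix.det_succ_column _ (Fin.last _), Finset.sum_eq_single (Fin.last _)]
  · rw [Matrix.sub_apply, hcol]
    simp [← two_mul, Fin.succAbove_last]
  · intro i _ hi
    rw [Matrix.sub_apply, hcol]
    simp [hi]
  · simp

/-- The characteristic polynomial of the Dirichlet restriction is bounded below by the product of
the `ρ_k` on and outside the unit circle. -/
theorem prod_rho_le_norm_det {z : ℂ} (hz : 1 ≤ ‖z‖) :
    rho (a (-n - 1)) * ∏ k ∈ Finset.Icc (-(n : ℤ)) n, rho (a k) ≤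
      ‖z‖ * ‖(Matrix.scalar _ z - dirichletMatrix (pCMV a l) n).det‖ := by
  have h1 : ∏ k ∈ Finset.Icc (-(n : ℤ)) n, rho (a k) =
      ∏ i : Fin (2 * n + 1), rho (a (site n i.castSucc)) := by
    rw [← Finset.prod_coe_sort]
    exact ((siteEquiv n).prod_comp fun p : Finset.Icc (-(n : ℤ)) n => rho (a p)).symm
  have h2 : z • 1 - blockMatrix a l n * cutMatrix a l n = blockMatrix a l n * pencil a l n z := by
    rw [pencil, mul_sub, Matrix.mul_smul, blockMatrix_mul_conjTranspose]
  rw [h1, det_scalar_sub_dirichletMatrix, ← norm_mul, ← det_smul_one_sub_blockMatrix_mul_cutMatrix,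
    h2, Matrix.det_mul, norm_mul, norm_det_blockMatrix, one_mul]
  exact prod_rho_le_norm_det_pencil a l n hz

end PCMV

/-! ### Spectral mapping with algebraic multiplicities -/

section Matrices

open Polynomial

variable {ι : Type*} [Fintype ι] [DecidableEq ι] (A : Matrix ι ι ℂ)

theorem Matrix.det_scalar_sub_eq_prod_roots (z : ℂ) :
    (Matrix.scalar ι z - A).det = (A.charpoly.roots.map fun w => z - w).prod := by
  rw [← Matrix.eval_charpoly]
  conv_lhs => rw [(IsAlgClosed.splits A.charpoly).eq_prod_roots_of_monic A.charpoly_monic]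
  rw [eval_multiset_prod, Multiset.map_map]
  simp

theorem Matrix.card_roots_charpoly : A.charpoly.roots.card = Fintype.card ι := by
  rw [← A.charpoly_natDegree_eq_dim, (IsAlgClosed.splits A.charpoly).natDegree_eq_card_roots]

/-- Both sides are multiplicative in p, so it suffices to treat constants and linear factors. -/
theorem Matrix.det_aeval_eq_prod_roots (p : ℂ[X]) :
    (aeval A p).det = (A.charpoly.roots.map fun w => p.eval w).prod := by
  have hlin : ∀ r : ℂ, (aeval A (X - C r)).det =
      (A.charpoly.roots.map fun w => (X - C r).eval w).prod := by
    intro r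
    have h1 : aeval A (X - C r) = -(Matrix.scalar ι r - A) := by
      simp [Matrix.algebraMap_eq_diagonal, Matrix.scalar_apply]
    rw [h1, Matrix.det_neg, Matrix.det_scalar_sub_eq_prod_roots, ← A.card_roots_charpoly,
      ← Multiset.card_map (fun w => r - w) A.charpoly.roots, ← Multiset.prod_map_neg,
      Multiset.map_map]
    simp
  have hprod : ∀ s : Multiset ℂ, (aeval A (s.map fun r => X - C r).prod).det =
      (A.charpoly.roots.map fun w => ((s.map fun r => X - C r).prod).eval w).prod := by
    intro s
    induction s using Multiset.induction_on with
    | empty => simp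
    | cons r s ih =>
      simp only [Multiset.map_cons, Multiset.prod_cons, map_mul, Matrix.det_mul, ih, hlin,
        eval_mul, Multiset.prod_map_mul]
  rw [(IsAlgClosed.splits p).eq_prod_roots, map_mul, Matrix.det_mul, hprod]
  simp only [eval_mul, Multiset.prod_map_mul, eval_C, Multiset.map_const', Multiset.prod_replicate,
    A.card_roots_charpoly]
  congr 1
  rw [aeval_C, Matrix.algebraMap_eq_diagonal]
  simp

theorem Matrix.roots_charpoly_pow (m : ℕ) :
    (A ^ m).charpoly.roots = A.charpoly.roots.map (· ^ m) := by
  have h : (A ^ m).charpoly = ((A.charpoly.roots.map (· ^ m)).map fun w => X - C w).prod := by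
    refine Polynomial.funext fun z => ?_
    rw [Matrix.eval_charpoly, eval_multiset_prod, Multiset.map_map, Multiset.map_map]
    have h1 : Matrix.scalar ι z - A ^ m = aeval A (C z - X ^ m) := by
      simp [Matrix.algebraMap_eq_diagonal, Matrix.scalar_apply]
    rw [h1, Matrix.det_aeval_eq_prod_roots]
    simp
  rw [h, roots_multiset_prod_X_sub_C]

theorem Matrix.trace_pow_eq_sum_roots (m : ℕ) :
    (A ^ m).trace = (A.charpoly.roots.map (· ^ m)).sum := by
  rw [Matrix.trace_eq_sum_roots_charpoly, Matrix.roots_charpoly_pow]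

end Matrices

/-! ### Eigenvalues of the Dirichlet restrictions -/

namespace PCMV

open Matrix

theorem integral_sum_dirac {F : Type*} [NormedAddCommGroup F] [NormedSpace ℝ F] [CompleteSpace F]
    (h : ℂ → F) (s : Multiset ℂ) :
    Integrable h (s.map Measure.dirac).sum ∧
      ∫ z, h z ∂(s.map Measure.dirac).sum = (s.map h).sum := by
  induction s using Multiset.induction_on with
  | empty => simp
  | cons w s ih =>
    have hw : Integrable h (Measure.dirac w) := integrable_dirac (by simp)
    simp only [Multiset.map_cons, Multiset.sum_cons]
    exact ⟨hw.add_measure ih.1, by rw [integral_add_measure hw ih.1, integral_dirac, ih.2]⟩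

theorem integral_countingMeasure {F : Type*} [NormedAddCommGroup F] [NormedSpace ℝ F]
    [CompleteSpace F] (E : HilbertZ →L[ℂ] HilbertZ) (n : ℕ) (h : ℂ → F) :
    ∫ z, h z ∂(countingMeasure E n) =
      (2 * n + 1 : ℝ)⁻¹ • ((dirichletMatrix E n).charpoly.roots.map h).sum := by
  rw [countingMeasure, integral_smul_measure, (integral_sum_dirac h _).2, ENNReal.toReal_inv]
  congr 2

variable (a : ℤ → Disk) (l : ℤ → UCircle) (n : ℕ)

theorem prod_rho_pos : 0 < rho (a (-n - 1)) * ∏ k ∈ Finset.Icc (-(n : ℤ)) n, rho (a k) :=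
  mul_pos (rho_pos _) (Finset.prod_pos fun _ _ => rho_pos _)

/-- On or outside the unit circle the characteristic polynomial has a positive lower bound. -/
theorem norm_root_lt_one {w : ℂ} (hw : w ∈ (dirichletMatrix (pCMV a l) n).charpoly.roots) :
    ‖w‖ < 1 := by
  by_contra! h
  have h1 := prod_rho_le_norm_det a l n h
  rw [← Matrix.eval_charpoly, (Polynomial.mem_roots'.mp hw).2] at h1
  simp only [norm_zero, mul_zero] at h1
  exact absurd (prod_rho_pos a n) (not_lt.mpr h1)

theorem sum_log_rho_le_sum_log {z : ℂ} (hz : 1 < ‖z‖) :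
    ∑ k ∈ Finset.Icc (-(n : ℤ)) n, Real.log (rho (a k)) + Real.log (rho (a (-n - 1))) -
        Real.log ‖z‖ ≤
      ((dirichletMatrix (pCMV a l) n).charpoly.roots.map fun w => Real.log ‖z - w‖).sum := by
  have hlog : ∀ s : Multiset ℂ, (∀ w ∈ s, ‖w‖ < 1) → (s.map fun w => z - w).prod ≠ 0 ∧
      (s.map fun w => Real.log ‖z - w‖).sum = Real.log ‖(s.map fun w => z - w).prod‖ := by
    intro s
    induction s using Multiset.induction_on with
    | empty => simp
    | cons w s ih =>
      intro h
      obtain ⟨h1, h2⟩ := ih fun v hv => h v (Multiset.mem_cons_of_mem hv)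
      have hw : z - w ≠ 0 := by
        intro h0
        rw [sub_eq_zero] at h0
        have := h w (Multiset.mem_cons_self w s)
        rw [← h0] at this
        linarith
      simp only [Multiset.map_cons, Multiset.prod_cons, Multiset.sum_cons, norm_mul, h2]
      exact ⟨mul_ne_zero hw h1,
        (Real.log_mul (norm_ne_zero_iff.mpr hw) (norm_ne_zero_iff.mpr h1)).symm⟩
  obtain ⟨h0, h1⟩ := hlog _ fun w => norm_root_lt_one a l n (w := w)
  have h2 := prod_rho_le_norm_det a l n hz.le
  rw [Matrix.det_scalar_sub_eq_prod_roots] at h2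
  have h3 := Real.log_le_log (prod_rho_pos a n) h2
  rw [Real.log_mul (rho_pos _).ne' (Finset.prod_pos fun _ _ => rho_pos _).ne',
    Real.log_prod fun _ _ => (rho_pos _).ne',
    Real.log_mul (by positivity) (norm_ne_zero_iff.mpr h0)] at h3
  rw [h1]
  linarith

/-! ### Traces of powers: restricting before or after taking the power -/

section Trace

/-- The inclusion of the window `[-n, n]`. -/
abbrev window (n : ℕ) : Finset.Icc (-(n : ℤ)) n → ℤ := Subtype.val

theorem window_injective : Function.Injective (window n) := Subtype.val_injective

theorem dirichletMatrix_mulVec (E : HilbertZ →L[ℂ] HilbertZ) (v : Finset.Icc (-(n : ℤ)) n → ℂ)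
    (i : Finset.Icc (-(n : ℤ)) n) :
    (dirichletMatrix E n *ᵥ v) i = E (embed (window n) v) i := by
  change ∑ j, dirichletMatrix E n i j * v j = _
  rw [embed, map_sum, lp.coeFn_sum, Finset.sum_apply]
  refine Finset.sum_congr rfl fun j _ => ?_
  rw [map_smul, lp.coeFn_smul, Pi.smul_apply, smul_eq_mul, mul_comm, dirichletMatrix,
    inner_delta_left]

theorem norm_dirichletMatrix_pow_le {E : HilbertZ →L[ℂ] HilbertZ}
    (hE : E ∈ unitary (HilbertZ →L[ℂ] HilbertZ)) (m : ℕ) (i : Finset.Icc (-(n : ℤ)) n) :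
    ‖(dirichletMatrix E n ^ m) i i‖ ≤ 1 := by
  have h : ∀ m : ℕ, ∑ j, ‖((dirichletMatrix E n ^ m) *ᵥ Pi.single i 1) j‖ ^ 2 ≤ 1 := by
    intro m
    induction m with
    | zero =>
      rw [pow_zero, Matrix.one_mulVec, Finset.sum_eq_single i]
      · simp
      · intro j _ hj
        simp [hj]
      · simp
    | succ m ih =>
      refine le_trans ?_ ih
      rw [pow_succ', ← Matrix.mulVec_mulVec, ← norm_embed_sq (window_injective n)
        ((dirichletMatrix E n ^ m) *ᵥ Pi.single i 1), ← norm_apply_of_mem_unitary hE]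
      simp only [dirichletMatrix_mulVec]
      exact sum_norm_sq_le_norm_sq (window_injective n) _
  have h1 := (Finset.single_le_sum (fun j _ => sq_nonneg _) (Finset.mem_univ i)).trans (h m)
  rw [Matrix.mulVec_single_one] at h1
  exact (sq_le_one_iff₀ (norm_nonneg _)).mp h1

theorem thetaFun_eq_zero_of_support {s c : ℤ} {r : ℤ} {u : ℤ → ℂ}
    (hu : ∀ k, r < |k - c| → u k = 0) (k : ℤ) (hk : r + 1 < |k - c|) : thetaFun a l s u k = 0 := by
  rw [lt_abs] at hk
  have h0 : u k = 0 := hu k (by rw [lt_abs]; omega)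
  have h1 : u (k + 1) = 0 := hu _ (by rw [lt_abs]; omega)
  have h2 : u (k - 1) = 0 := hu _ (by rw [lt_abs]; omega)
  simp [thetaFun, h0, h1, h2]

theorem pCMV_pow_delta_eq_zero (m : ℕ) (c k : ℤ) (hk : 2 * (m : ℤ) < |k - c|) :
    (pCMV a l ^ m) (delta c) k = 0 := by
  induction m generalizing k with
  | zero =>
    have : k ≠ c := by
      rintro rfl
      simp at hk
    simp [delta_apply, this]
  | succ m ih =>
    rw [pow_succ']
    refine thetaFun_eq_zero_of_support a l (s := 0) (c := c) (r := 2 * m + 1) ?_ k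
      (by push_cast at hk; omega)
    exact fun k hk => thetaFun_eq_zero_of_support a l (s := 1) (c := c) (r := 2 * m) ih k hk

/-- Each application of 𝓔 spreads supports by at most two sites, so a vector started at distance at
least 2m from the boundary never notices the truncation. -/
theorem dirichletMatrix_pow_apply (m : ℕ) (i : Finset.Icc (-(n : ℤ)) n)
    (hi : |(i : ℤ)| + 2 * m ≤ n) (j : Finset.Icc (-(n : ℤ)) n) :
    (dirichletMatrix (pCMV a l) n ^ m) j i = (pCMV a l ^ m) (delta i) j := by
  induction m generalizing j with
  | zero =>
    rw [pow_zero, Matrix.one_apply, pow_zero, one_apply_eq_self, delta_apply]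
    simp only [Subtype.ext_iff]
  | succ m ih =>
    have hi' : |(i : ℤ)| + 2 * m ≤ n := by push_cast at hi; omega
    have h1 : embed (window n) (fun j => (dirichletMatrix (pCMV a l) n ^ m) j i) =
        (pCMV a l ^ m) (delta i) := by
      ext k
      by_cases hk : k ∈ Finset.Icc (-(n : ℤ)) n
      · have := embed_apply_self (window_injective n)
          (fun j => (dirichletMatrix (pCMV a l) n ^ m) j i) ⟨k, hk⟩
        rw [ih hi'] at this
        exact this
      · rw [embed_apply_of_notMem, pCMV_pow_delta_eq_zero]
        · rw [Finset.mem_Icc] at hk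
          have h2 := abs_le.mp (show |(i : ℤ)| ≤ n - 2 * m by omega)
          rw [lt_abs]
          omega
        · rintro ⟨k', hk'⟩ rfl
          exact hk hk'
    have h2 := dirichletMatrix_mulVec n (pCMV a l)
      (fun j => (dirichletMatrix (pCMV a l) n ^ m) j i) j
    rw [h1] at h2
    rw [pow_succ', Matrix.mul_apply, pow_succ']
    exact h2

/-- At most 2(2m+1) sites near the two ends contribute, each at most 2, since unitaries and their
compressions are contractions. -/
theorem norm_trace_sub_le (m : ℕ) :
    ‖(dirichletMatrix (pCMV a l) n ^ m).trace -
      ∑ k ∈ Finset.Icc (-(n : ℤ)) n, (pCMV a l ^ m) (delta k) k‖ ≤ 8 * m + 4 := by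
  rw [Matrix.trace, ← Finset.sum_coe_sort (Finset.Icc (-(n : ℤ)) n), ← Finset.sum_sub_distrib]
  refine (norm_sum_le _ _).trans ?_
  have h1 : ∀ i : Finset.Icc (-(n : ℤ)) n,
      ‖(dirichletMatrix (pCMV a l) n ^ m).diag i - (pCMV a l ^ m) (delta i) i‖ ≤
        if |(i : ℤ)| + 2 * m ≤ n then 0 else 2 := by
    intro i
    rw [Matrix.diag_apply]
    split_ifs with hi
    · rw [dirichletMatrix_pow_apply a l n m i hi, sub_self, norm_zero]
    · refine (norm_sub_le _ _).trans ?_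
      linarith [norm_dirichletMatrix_pow_le n (pCMV_mem_unitary a l) m i,
        norm_diag_pow_le (pCMV_mem_unitary a l) m i]
  refine (Finset.sum_le_sum fun i _ => h1 i).trans ?_
  rw [Finset.sum_coe_sort (Finset.Icc (-(n : ℤ)) n)
    (fun i : ℤ => if |i| + 2 * m ≤ n then (0 : ℝ) else 2), Finset.sum_ite, Finset.sum_const_zero,
    zero_add, Finset.sum_const, nsmul_eq_mul]
  have hsub : (Finset.Icc (-(n : ℤ)) n).filter (fun i : ℤ => ¬ |i| + 2 * m ≤ n) ⊆
      Finset.Icc (-(n : ℤ)) (-n + 2 * m) ∪ Finset.Icc ((n : ℤ) - 2 * m) n := by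
    intro i hi
    simp only [Finset.mem_filter, Finset.mem_Icc, Finset.mem_union] at hi ⊢
    rcases abs_cases i with h | h <;> omega
  have hcard := (Finset.card_le_card hsub).trans (Finset.card_union_le _ _)
  have h2 : (Finset.Icc (-(n : ℤ)) (-n + 2 * m)).card = 2 * m + 1 := by
    rw [Int.card_Icc]; omega
  have h3 : (Finset.Icc ((n : ℤ) - 2 * m) n).card = 2 * m + 1 := by
    rw [Int.card_Icc]; omega
  rw [h2, h3] at hcard
  have : (((Finset.Icc (-(n : ℤ)) n).filter (fun i : ℤ => ¬ |i| + 2 * m ≤ n)).card : ℝ) ≤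
      2 * m + 1 + (2 * m + 1) := by exact_mod_cast hcard
  linarith

theorem tendsto_inv_two_mul_add_one :
    Tendsto (fun n : ℕ => (2 * n + 1 : ℝ)⁻¹) atTop (𝓝 0) :=
  tendsto_inv_atTop_zero.comp (tendsto_atTop_add_const_right _ _
    (tendsto_natCast_atTop_atTop.const_mul_atTop two_pos))

theorem norm_two_mul_add_one (n : ℕ) : ‖(2 * n + 1 : ℂ)‖ = 2 * n + 1 := by
  rw [show (2 * n + 1 : ℂ) = ((2 * n + 1 : ℝ) : ℂ) by push_cast; rfl, Complex.norm_real,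
    Real.norm_of_nonneg (by positivity)]

theorem tendsto_inv_mul_of_bounded {x : ℕ → ℂ} {C : ℝ} (hx : ∀ n, ‖x n‖ ≤ C) :
    Tendsto (fun n : ℕ => (2 * n + 1 : ℂ)⁻¹ * x n) atTop (𝓝 0) := by
  refine squeeze_zero_norm (a := fun n : ℕ => (2 * n + 1 : ℝ)⁻¹ * C) (fun n => ?_) ?_
  · rw [norm_mul, norm_inv, norm_two_mul_add_one]
    gcongr
    exact hx n
  · simpa using tendsto_inv_two_mul_add_one.mul_const C

/-- The normalized traces of powers of an extended pCMV matrix and of its Dirichlet restrictions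
have the same limits. -/
theorem tendsto_sum_roots_pow_of_tendsto (m : ℕ) {c : ℂ}
    (h : Tendsto (fun n : ℕ => (2 * n + 1 : ℂ)⁻¹ *
      ∑ k ∈ Finset.Icc (-(n : ℤ)) n, (pCMV a l ^ m) (delta k) k) atTop (𝓝 c)) :
    Tendsto (fun n : ℕ => (2 * n + 1 : ℂ)⁻¹ *
      ((dirichletMatrix (pCMV a l) n).charpoly.roots.map (· ^ m)).sum) atTop (𝓝 c) := by
  have h1 := (tendsto_inv_mul_of_bounded fun n => norm_trace_sub_le a l n m).add h
  rw [zero_add] at h1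
  refine h1.congr fun n => ?_
  rw [Matrix.trace_pow_eq_sum_roots]
  ring

end Trace

end PCMV

/-! ### Measures on the circle and their moments -/

namespace PCMV

/-- The coordinate function on the unit circle. -/
def circleId : C(UCircle, ℂ) := ContinuousMap.restrict (Metric.sphere (0 : ℂ) 1) (.id ℂ)

theorem circleId_mem_unitary : circleId ∈ unitary C(UCircle, ℂ) := by
  rw [Unitary.mem_iff]
  constructor <;> ext z
  · exact (mul_comm _ _).trans (circle_mul_conj z)
  · exact circle_mul_conj z

/-- A closed subspace of continuous functions on the circle that contains `z ^ m` and `conj z ^ m`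
for all `m` is everything. -/
theorem submodule_circle_eq_top (K : Submodule ℂ C(UCircle, ℂ))
    (hK : IsClosed (K : Set C(UCircle, ℂ)))
    (h : ∀ m : ℕ, circleId ^ m ∈ K) (h' : ∀ m : ℕ, star (circleId ^ m) ∈ K) (φ : C(UCircle, ℂ)) :
    φ ∈ K := by
  set u : unitary C(UCircle, ℂ) := ⟨circleId, circleId_mem_unitary⟩
  have hz : ∀ k : ℤ, ((u ^ k : unitary C(UCircle, ℂ)) : C(UCircle, ℂ)) ∈ K := by
    intro k
    obtain ⟨m, rfl | rfl⟩ := k.eq_nat_or_neg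
    · rw [zpow_natCast]
      exact h m
    · rw [zpow_neg, zpow_natCast]
      exact h' m
  have hmon : ∀ x ∈ Submonoid.closure ({circleId} ∪ star {circleId} : Set C(UCircle, ℂ)),
      ∃ k : ℤ, x = ((u ^ k : unitary C(UCircle, ℂ)) : C(UCircle, ℂ)) := by
    intro x hx
    induction hx using Submonoid.closure_induction with
    | mem x hx =>
      rcases hx with hx | hx
      · exact ⟨1, by rw [zpow_one]; exact hx⟩
      · refine ⟨-1, ?_⟩
        rw [zpow_neg, zpow_one]
        rw [Set.mem_star, Set.mem_singleton_iff, star_eq_iff_star_eq] at hx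
        exact hx.symm
    | one => exact ⟨0, by simp⟩
    | mul x y _ _ hx hy =>
      obtain ⟨i, rfl⟩ := hx
      obtain ⟨j, rfl⟩ := hy
      exact ⟨i + j, by rw [zpow_add]; rfl⟩
  have hadj : (StarAlgebra.adjoin ℂ ({circleId} : Set C(UCircle, ℂ)) : Set C(UCircle, ℂ)) ⊆ K := by
    intro x hx
    have : x ∈ (StarAlgebra.adjoin ℂ ({circleId} : Set C(UCircle, ℂ))).toSubalgebra.toSubmodule := hx
    rw [StarAlgebra.adjoin_eq_span] at this
    refine Submodule.span_le.mpr (fun y hy => ?_) this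
    obtain ⟨k, rfl⟩ := hmon y hy
    exact hz k
  have htop : φ ∈ StarAlgebra.elemental ℂ circleId := by
    rw [circleId, ContinuousMap.elemental_id_eq_top]
    exact StarSubalgebra.mem_top
  exact closure_minimal hadj hK htop

/-- Integration against a measure carried by the circle, as integration on the circle. -/
theorem integral_eq_integral_comap {F : Type*} [NormedAddCommGroup F] [NormedSpace ℝ F]
    {ν : Measure ℂ} (hν : ν (Metric.sphere (0 : ℂ) 1)ᶜ = 0) (h : ℂ → F) :
    ∫ z, h z ∂ν = ∫ z : UCircle, h z ∂(ν.comap Subtype.val) := by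
  rw [integral_subtype_comap Metric.isClosed_sphere.measurableSet,
    Measure.restrict_eq_self_of_ae_mem (by rw [ae_iff]; exact hν)]

theorem integrable_circle (ν : Measure UCircle) [IsFiniteMeasure ν] (φ : C(UCircle, ℂ)) :
    Integrable φ ν :=
  (BoundedContinuousFunction.mkOfCompact φ).integrable ν

/-- The integral against a finite measure on the circle, as a continuous linear functional. -/
def circleIntegral (ν : Measure UCircle) [IsFiniteMeasure ν] : C(UCircle, ℂ) →L[ℂ] ℂ :=
  LinearMap.mkContinuous
    { toFun := fun φ => ∫ z, φ z ∂ν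
      map_add' := fun φ ψ => integral_add (integrable_circle ν φ) (integrable_circle ν ψ)
      map_smul' := fun c φ => integral_const_mul c _ } (ν.real Set.univ) fun φ => by
    rw [mul_comm]
    exact norm_integral_le_of_norm_le_const (ae_of_all _ fun z => φ.norm_coe_le_norm z)

theorem circleIntegral_apply (ν : Measure UCircle) [IsFiniteMeasure ν] (φ : C(UCircle, ℂ)) :
    circleIntegral ν φ = ∫ z, φ z ∂ν := rfl

theorem circleIntegral_star (ν : Measure UCircle) [IsFiniteMeasure ν] (φ : C(UCircle, ℂ)) :
    circleIntegral ν (star φ) = conj (circleIntegral ν φ) := integral_conj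

/-- Finite measures carried by the unit circle are determined by their moments. -/
theorem measure_eq_of_moments {ν ν' : Measure ℂ} [IsFiniteMeasure ν] [IsFiniteMeasure ν']
    (hν : ν (Metric.sphere (0 : ℂ) 1)ᶜ = 0) (hν' : ν' (Metric.sphere (0 : ℂ) 1)ᶜ = 0)
    (h : ∀ m : ℕ, ∫ z, z ^ m ∂ν = ∫ z, z ^ m ∂ν') : ν = ν' := by
  have hmom : ∀ m : ℕ, circleIntegral (ν.comap Subtype.val) (circleId ^ m) =
      circleIntegral (ν'.comap Subtype.val) (circleId ^ m) := by
    intro m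
    have := h m
    rwa [integral_eq_integral_comap hν, integral_eq_integral_comap hν'] at this
  have hall : ∀ φ, circleIntegral (ν.comap Subtype.val) φ =
      circleIntegral (ν'.comap Subtype.val) φ := by
    intro φ
    refine submodule_circle_eq_top
      (LinearMap.eqLocus (circleIntegral (ν.comap Subtype.val)).toLinearMap
        (circleIntegral (ν'.comap Subtype.val)).toLinearMap)
      (isClosed_eq (ContinuousLinearMap.continuous _) (ContinuousLinearMap.continuous _)) hmom
      (fun m => ?_) φ
    change circleIntegral _ _ = circleIntegral _ _
    rw [circleIntegral_star, circleIntegral_star, hmom]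
  refine ext_of_forall_integral_eq_of_IsFiniteMeasure fun f => ?_
  have := hall ⟨fun z => (f z : ℂ), by fun_prop⟩
  rw [circleIntegral_apply, circleIntegral_apply] at this
  change ∫ z : UCircle, (f z : ℂ) ∂_ = ∫ z : UCircle, (f z : ℂ) ∂_ at this
  rw [integral_complex_ofReal, integral_complex_ofReal, ← integral_eq_integral_comap hν (fun z => f z),
    ← integral_eq_integral_comap hν' (fun z => f z)] at this
  exact_mod_cast this

/-- The normalized trace of the compression to `ℓ²([-n, n])`. -/
def avgTrace (n : ℕ) : (HilbertZ →L[ℂ] HilbertZ) →ₗ[ℂ] ℂ where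
  toFun A := (2 * n + 1 : ℂ)⁻¹ * ∑ k ∈ Finset.Icc (-(n : ℤ)) n, inner ℂ (delta k) (A (delta k))
  map_add' A B := by
    simp only [add_apply, inner_add_right, Finset.sum_add_distrib, mul_add]
  map_smul' c A := by
    simp only [smul_apply, inner_smul_right, ← Finset.mul_sum, RingHom.id_apply,
      smul_eq_mul]
    ring

theorem avgTrace_apply (n : ℕ) (A : HilbertZ →L[ℂ] HilbertZ) : avgTrace n A =
    (2 * n + 1 : ℂ)⁻¹ * ∑ k ∈ Finset.Icc (-(n : ℤ)) n, inner ℂ (delta k) (A (delta k)) := rfl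

theorem card_Icc_neg_self (n : ℕ) : (Finset.Icc (-(n : ℤ)) n).card = 2 * n + 1 := by
  rw [Int.card_Icc]; omega

theorem norm_avgTrace_le (n : ℕ) (A : HilbertZ →L[ℂ] HilbertZ) : ‖avgTrace n A‖ ≤ ‖A‖ := by
  have h : ‖∑ k ∈ Finset.Icc (-(n : ℤ)) n, inner ℂ (delta k) (A (delta k))‖ ≤
      (2 * n + 1) * ‖A‖ := by
    refine (norm_sum_le_of_le _ fun k _ => ?_).trans
      (le_of_eq (by rw [Finset.sum_const, card_Icc_neg_self, nsmul_eq_mul]; push_cast; rfl))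
    refine (norm_inner_le_norm _ _).trans ?_
    simpa [norm_delta] using A.le_opNorm (delta k)
  rw [avgTrace_apply, norm_mul, norm_inv, norm_two_mul_add_one, inv_mul_le_iff₀ (by positivity)]
  exact h

theorem avgTrace_star (n : ℕ) (A : HilbertZ →L[ℂ] HilbertZ) :
    avgTrace n (star A) = conj (avgTrace n A) := by
  simp only [avgTrace_apply, map_mul, map_inv₀, map_add, map_natCast, map_ofNat, map_one, map_sum,
    inner_conj_symm, ContinuousLinearMap.star_eq_adjoint, ContinuousLinearMap.adjoint_inner_right]

theorem avgTrace_one (n : ℕ) : avgTrace n 1 = 1 := by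
  have h : (2 * n + 1 : ℂ) ≠ 0 := by
    rw [← norm_ne_zero_iff, norm_two_mul_add_one]
    positivity
  simp only [avgTrace_apply, one_apply_eq_self, inner_self_eq_norm_sq_to_K, norm_delta]
  rw [Finset.sum_const, card_Icc_neg_self]
  simp [h]

theorem re_avgTrace_star_mul_self_nonneg (n : ℕ) (A : HilbertZ →L[ℂ] HilbertZ) :
    0 ≤ (avgTrace n (star A * A)).re := by
  have h : avgTrace n (star A * A) = (((2 * n + 1 : ℝ)⁻¹ *
      ∑ k ∈ Finset.Icc (-(n : ℤ)) n, ‖A (delta k)‖ ^ 2 : ℝ) : ℂ) := by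
    simp only [avgTrace_apply, mul_apply_eq_comp, ContinuousLinearMap.star_eq_adjoint,
      ContinuousLinearMap.adjoint_inner_right, inner_self_eq_norm_sq_to_K]
    push_cast
    rfl
  rw [h, Complex.ofReal_re]
  positivity

/-! ### Functional calculus and construction of the density of states -/

section Functional

variable {E : HilbertZ →L[ℂ] HilbertZ}

/-- The continuous functional calculus of a unitary operator, for functions on the circle. -/
def circleHom (hE : E ∈ unitary (HilbertZ →L[ℂ] HilbertZ)) :
    C(UCircle, ℂ) →⋆ₐ[ℂ] (HilbertZ →L[ℂ] HilbertZ) :=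
  (cfcHom (R := ℂ) (a := E) (isStarNormal_of_mem_unitary hE)).comp
    (ContinuousMap.compStarAlgHom' ℂ ℂ
      ⟨Set.inclusion (spectrum.subset_circle_of_unitary (𝕜 := ℂ) hE), continuous_inclusion _⟩)

theorem circleHom_circleId (hE : E ∈ unitary (HilbertZ →L[ℂ] HilbertZ)) :
    circleHom hE circleId = E :=
  cfcHom_id (R := ℂ) (isStarNormal_of_mem_unitary hE)

theorem cfc_eq_circleHom (hE : E ∈ unitary (HilbertZ →L[ℂ] HilbertZ))
    {h : ℂ → ℂ} (hh : Continuous h) :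
    cfc h E = circleHom hE ⟨fun z => h z, by fun_prop⟩ := by
  rw [cfc_apply h E (isStarNormal_of_mem_unitary hE) hh.continuousOn]
  rfl

theorem norm_avgTrace_circleHom_le (hE : E ∈ unitary (HilbertZ →L[ℂ] HilbertZ))
    (n : ℕ) (φ : C(UCircle, ℂ)) :
    ‖avgTrace n (circleHom hE φ)‖ ≤ ‖φ‖ :=
  (norm_avgTrace_le n _).trans (NonUnitalStarAlgHom.norm_apply_le (circleHom hE) φ)

/-- The functions whose averaged traces converge to the integral form a closed subspace, since both
functionals are bounded uniformly in n. It contains the powers of z and, by taking adjoints, their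
conjugates, hence all continuous functions on the circle. -/
theorem isDOS_of_moments (hE : E ∈ unitary (HilbertZ →L[ℂ] HilbertZ))
    {ν : Measure ℂ} [IsProbabilityMeasure ν]
    (hν : ν (Metric.sphere (0 : ℂ) 1)ᶜ = 0)
    (h : ∀ m : ℕ, Tendsto (fun n => avgTrace n (E ^ m)) atTop (𝓝 (∫ z, z ^ m ∂ν))) :
    IsDOS E ν := by
  refine ⟨inferInstance, hν, fun f hf => ?_⟩
  set J := circleIntegral (ν.comap Subtype.val) with hJ
  let K : Submodule ℂ C(UCircle, ℂ) :=
    { carrier := {φ | Tendsto (fun n => avgTrace n (circleHom hE φ)) atTop (𝓝 (J φ))}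
      zero_mem' := by simp
      add_mem' := fun {φ ψ} hφ hψ => by
        simpa only [Set.mem_ofPred_eq, map_add] using Tendsto.add hφ hψ
      smul_mem' := fun c φ hφ => by
        simpa only [Set.mem_ofPred_eq, map_smul] using Tendsto.const_smul hφ c }
  have hK : IsClosed (K : Set C(UCircle, ℂ)) := by
    refine isClosed_of_closure_subset fun φ hφ => ?_
    change Tendsto _ _ _
    rw [Metric.tendsto_nhds]
    intro ε hε
    set M := ‖J‖ + 2 with hM
    have hM0 : 0 < M := by positivity
    obtain ⟨ψ, hψK, hψ⟩ := Metric.mem_closure_iff.mp hφ (ε / M) (by positivity)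
    have hψK' : Tendsto (fun n => avgTrace n (circleHom hE ψ)) atTop (𝓝 (J ψ)) := hψK
    filter_upwards [Metric.tendsto_nhds.mp hψK' (ε / M) (by positivity)] with n hn
    rw [dist_eq_norm] at hn hψ ⊢
    have e : avgTrace n (circleHom hE φ) - J φ = avgTrace n (circleHom hE (φ - ψ)) +
        (avgTrace n (circleHom hE ψ) - J ψ) - J (φ - ψ) := by
      simp only [map_sub]; ring
    have h1 := norm_avgTrace_circleHom_le hE n (φ - ψ)
    have h2 := J.le_opNorm (φ - ψ)
    have h3 : ‖J‖ * ‖φ - ψ‖ ≤ ‖J‖ * (ε / M) := by gcongr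
    have h4 : ε = ‖J‖ * (ε / M) + 2 * (ε / M) := by rw [← add_mul, ← hM]; field_simp
    rw [e]
    refine (norm_sub_le _ _).trans_lt (lt_of_le_of_lt (add_le_add_left (norm_add_le _ _) _) ?_)
    linarith
  have hpow : ∀ m : ℕ, circleId ^ m ∈ K := by
    intro m
    change Tendsto _ _ _
    have := h m
    rw [integral_eq_integral_comap hν] at this
    simp only [map_pow, circleHom_circleId]
    exact this
  have hmem := submodule_circle_eq_top K hK hpow (fun m => by
    change Tendsto _ _ _
    have h1 : Tendsto (fun n => avgTrace n (circleHom hE (circleId ^ m))) atTop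
      (𝓝 (J (circleId ^ m))) := hpow m
    simp only [map_star, avgTrace_star, hJ, circleIntegral_star]
    exact (Complex.continuous_conj.tendsto _).comp h1) ⟨fun z => f z, by fun_prop⟩
  rw [integral_eq_integral_comap hν]
  simp only [cfc_eq_circleHom hE hf]
  exact hmem

/-- If the normalized traces of the powers of a unitary operator converge, their limits are the
moments of a probability measure on the circle. -/
theorem exists_measure_of_moments (hE : E ∈ unitary (HilbertZ →L[ℂ] HilbertZ)) {c : ℕ → ℂ}
    (h : ∀ m : ℕ, Tendsto (fun n => avgTrace n (E ^ m)) atTop (𝓝 (c m))) :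
    ∃ ν : Measure ℂ, IsProbabilityMeasure ν ∧ ν (Metric.sphere (0 : ℂ) 1)ᶜ = 0 ∧
      ∀ m : ℕ, ∫ z, z ^ m ∂ν = c m := by
  -- Ultrafilter limits of the bounded averages exist for all φ at once and are automatically linear
  -- and positive; on powers of z they agree with the given limits.
  set U : Ultrafilter ℕ := hyperfilter ℕ with hU
  have hUle : (U : Filter ℕ) ≤ atTop := Nat.hyperfilter_le_atTop
  have hex : ∀ φ : C(UCircle, ℂ), ∃ x : ℂ,
      Tendsto (fun n => avgTrace n (circleHom hE φ)) U (𝓝 x) := by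
    intro φ
    obtain ⟨x, -, hx⟩ := (isCompact_closedBall (0 : ℂ) ‖φ‖).ultrafilter_le_nhds
      (U.map fun n => avgTrace n (circleHom hE φ)) (by
        rw [le_principal_iff, Ultrafilter.mem_coe, Ultrafilter.mem_map]
        exact Filter.univ_mem' fun n =>
          mem_closedBall_zero_iff.mpr (norm_avgTrace_circleHom_le hE n φ))
    exact ⟨x, hx⟩
  choose Λ hΛ using hex
  have hadd : ∀ φ ψ, Λ (φ + ψ) = Λ φ + Λ ψ := fun φ ψ =>
    tendsto_nhds_unique (hΛ _) (by simpa only [map_add] using (hΛ φ).add (hΛ ψ))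
  have hsmul : ∀ (t : ℂ) φ, Λ (t • φ) = t * Λ φ := fun t φ =>
    tendsto_nhds_unique (hΛ _) (by
      simpa only [map_smul, smul_eq_mul] using (hΛ φ).const_mul t)
  have hstar : ∀ φ, Λ (star φ) = conj (Λ φ) := fun φ =>
    tendsto_nhds_unique (hΛ _) (by
      simpa only [map_star, avgTrace_star, Function.comp_def] using
        (Complex.continuous_conj.tendsto _).comp (hΛ φ))
  have hpos : ∀ φ, 0 ≤ (Λ (star φ * φ)).re := fun φ =>
    ge_of_tendsto' ((Complex.continuous_re.tendsto _).comp (hΛ _)) fun n => by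
      simpa only [Function.comp, map_mul, map_star] using re_avgTrace_star_mul_self_nonneg n _
  have hpow : ∀ m : ℕ, Λ (circleId ^ m) = c m := fun m =>
    tendsto_nhds_unique (hΛ _) (by
      simpa only [map_pow, circleHom_circleId] using (h m).mono_left hUle)
  have hone : Λ 1 = 1 :=
    tendsto_nhds_unique (hΛ _) (by simp only [map_one, avgTrace_one]; exact tendsto_const_nhds)
  let toC : C(UCircle, ℝ) → C(UCircle, ℂ) := fun f => ⟨fun z => (f z : ℂ), by fun_prop⟩
  have hreal : ∀ f, ((Λ (toC f)).re : ℂ) = Λ (toC f) := fun f => by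
    have : star (toC f) = toC f := by ext z; exact Complex.conj_ofReal _
    rw [← Complex.conj_eq_iff_re, ← hstar, this]
  let Λr : CompactlySupportedContinuousMap UCircle ℝ →ₚ[ℝ] ℝ := PositiveLinearMap.mk₀
    { toFun := fun f => (Λ (toC f)).re
      map_add' := fun f g => by
        rw [← Complex.add_re, ← hadd]
        congr 2
        ext z
        exact Complex.ofReal_add _ _
      map_smul' := fun t f => by
        have : toC ((t • f : CompactlySupportedContinuousMap UCircle ℝ)) = (t : ℂ) • toC f := by
          ext z
          exact Complex.ofReal_mul _ _
        rw [this, hsmul, Complex.re_ofReal_mul]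
        rfl } fun f hf => by
      -- A nonnegative function is |√f|², so positivity reduces to traces of A*A.
      let g : C(UCircle, ℂ) := toC ⟨fun z => Real.sqrt (f z), by fun_prop⟩
      have : toC f = star g * g := by
        ext z
        change (f z : ℂ) = conj (Real.sqrt (f z) : ℂ) * (Real.sqrt (f z) : ℂ)
        rw [Complex.conj_ofReal, ← Complex.ofReal_mul, Real.mul_self_sqrt (hf z)]
      change 0 ≤ (Λ (toC f)).re
      rw [this]
      exact hpos g
  set ν₀ := RealRMK.rieszMeasure Λr with hν₀
  have hint : ∀ f : C(UCircle, ℝ), ((∫ z, f z ∂ν₀ : ℝ) : ℂ) = Λ (toC f) := fun f => by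
    rw [← hreal]
    congr 1
    exact RealRMK.integral_rieszMeasure Λr ⟨f, HasCompactSupport.of_compactSpace f⟩
  have hintC : ∀ φ : C(UCircle, ℂ), ∫ z, φ z ∂ν₀ = Λ φ := by
    intro φ
    let fr : C(UCircle, ℝ) := ⟨fun z => (φ z).re, by fun_prop⟩
    let fi : C(UCircle, ℝ) := ⟨fun z => (φ z).im, by fun_prop⟩
    have e : φ = toC fr + Complex.I • toC fi := by
      ext z
      change φ z = ((φ z).re : ℂ) + Complex.I * ((φ z).im : ℂ)
      rw [mul_comm, Complex.re_add_im]
    have h1 := integral_re_add_im (integrable_circle ν₀ φ)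
    rw [← h1]
    conv_rhs => rw [e, hadd, hsmul, ← hint, ← hint, mul_comm]
    rfl
  refine ⟨ν₀.map Subtype.val, ?_, ?_, fun m => ?_⟩
  · have h1 : ν₀.real Set.univ = 1 := by
      have := hintC 1
      rw [hone] at this
      simpa using this
    have : IsProbabilityMeasure ν₀ := ⟨by
      rw [measureReal_def] at h1
      rw [← ENNReal.ofReal_toReal (measure_ne_top ν₀ _), h1, ENNReal.ofReal_one]⟩
    exact Measure.isProbabilityMeasure_map measurable_subtype_coe.aemeasurable
  · rw [Measure.map_apply measurable_subtype_coe Metric.isClosed_sphere.measurableSet.compl]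
    simp
  · rw [integral_map measurable_subtype_coe.aemeasurable (by fun_prop), ← hpow, ← hintC]
    rfl

end Functional

end PCMV

/-! ### Logarithmic potentials and log-Hölder continuity -/

namespace PCMV

instance isFiniteMeasure_arcLeb : IsFiniteMeasure arcLeb := by
  unfold arcLeb
  infer_instance

/-- The chord between two points of an arc is not longer than the arc. -/
theorem norm_sub_le_arcLeb {A : Set ℂ} (hA : IsArc A) {z w : ℂ} (hz : z ∈ A) (hw : w ∈ A) :
    ‖z - w‖ ≤ arcLeb.real A := by
  obtain ⟨J, hJ, rfl⟩ := hA
  obtain ⟨s, hs, rfl⟩ := hz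
  obtain ⟨t, ht, rfl⟩ := hw
  set e : ℝ → ℂ := fun θ => Complex.exp (θ * Complex.I) with he
  set G : ℝ → ℝ := fun θ => ‖e s - e θ‖ with hG
  have hec : Continuous e := by fun_prop
  have hLip : LipschitzWith 1 G := by
    refine LipschitzWith.of_dist_le_mul fun x y => ?_
    rw [NNReal.coe_one, one_mul, Real.dist_eq, Real.dist_eq]
    refine (abs_norm_sub_norm_le _ _).trans ?_
    have h1 : e s - e x - (e s - e y) = e x * (Complex.exp (((y - x : ℝ)) * Complex.I) - 1) := by
      simp only [he, mul_sub, ← Complex.exp_add, mul_one]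
      rw [show (x : ℂ) * Complex.I + ((y - x : ℝ) : ℂ) * Complex.I = y * Complex.I by
        push_cast; ring]
      ring
    rw [h1, norm_mul, he, Complex.norm_exp_ofReal_mul_I, one_mul, abs_sub_comm, mul_comm]
    exact Real.norm_exp_I_mul_ofReal_sub_one_le
  -- By the intermediate value theorem, the distance from one endpoint takes every value up to the
  -- chord length on the arc. Reducing angles by `arg` moves these points into (-π, π]; a
  -- 1-Lipschitz map does not increase length.
  have hsub : Set.Icc 0 (G t) ⊆ G '' (e ⁻¹' (e '' J) ∩ Set.Ioc (-Real.pi) Real.pi) := by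
    intro y hy
    have h0 : G s = 0 := by simp [hG]
    have h1 := intermediate_value_uIcc (f := G) (a := s) (b := t) hLip.continuous.continuousOn
    rw [h0] at h1
    obtain ⟨θ, hθ, rfl⟩ := h1 (Set.Icc_subset_uIcc hy)
    have hθJ : θ ∈ J := hJ.uIcc_subset hs ht hθ
    have hper : e ((Complex.exp (θ * Complex.I)).arg) = e θ := by
      have := Complex.norm_mul_exp_arg_mul_I (Complex.exp (θ * Complex.I))
      rw [Complex.norm_exp_ofReal_mul_I] at this
      simpa [he] using this
    refine ⟨(Complex.exp (θ * Complex.I)).arg, ⟨⟨θ, hθJ, hper.symm⟩, Complex.arg_mem_Ioc _⟩, ?_⟩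
    simp only [hG, hper]
  have hvol : ENNReal.ofReal (G t) ≤ arcLeb (e '' J) := by
    calc ENNReal.ofReal (G t) = volume (Set.Icc 0 (G t)) := by rw [Real.volume_Icc, sub_zero]
      _ ≤ volume (G '' (e ⁻¹' (e '' J) ∩ Set.Ioc (-Real.pi) Real.pi)) := measure_mono hsub
      _ ≤ volume (e ⁻¹' (e '' J) ∩ Set.Ioc (-Real.pi) Real.pi) := by
        have := hLip.hausdorffMeasure_image_le zero_le_one
          (e ⁻¹' (e '' J) ∩ Set.Ioc (-Real.pi) Real.pi)
        simpa [hausdorffMeasure_real] using this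
      _ ≤ volume.restrict (Set.Ioc (-Real.pi) Real.pi) (e ⁻¹' (e '' J)) :=
        Measure.le_restrict_apply _ _
      _ ≤ arcLeb (e '' J) := Measure.le_map_apply hec.measurable.aemeasurable _
  exact (ENNReal.ofReal_le_iff_le_toReal (measure_ne_top _ _)).mp hvol

/-- The function `log |z - w|` of `w`, cut off outside the closed unit disk. -/
def logPotential (z : ℂ) (hz : 1 < ‖z‖) : BoundedContinuousFunction ℂ ℝ :=
  BoundedContinuousFunction.ofNormedAddCommGroup
    (fun w => Real.log (max (‖z‖ - 1) (min (‖z‖ + 1) ‖z - w‖)))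
    (Continuous.log (by fun_prop) fun w =>
      (lt_of_lt_of_le (sub_pos.mpr hz) (le_max_left _ _)).ne')
    (max |Real.log (‖z‖ - 1)| |Real.log (‖z‖ + 1)|) fun w => by
      have h0 : 0 < ‖z‖ - 1 := sub_pos.mpr hz
      have h1 := le_max_left (‖z‖ - 1) (min (‖z‖ + 1) ‖z - w‖)
      have h2 : max (‖z‖ - 1) (min (‖z‖ + 1) ‖z - w‖) ≤ ‖z‖ + 1 :=
        max_le (by linarith) (min_le_left _ _)
      exact abs_le_max_abs_abs (Real.log_le_log h0 h1) (Real.log_le_log (h0.trans_le h1) h2)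

theorem logPotential_apply {z : ℂ} (hz : 1 < ‖z‖) (w : ℂ) :
    logPotential z hz w = Real.log (max (‖z‖ - 1) (min (‖z‖ + 1) ‖z - w‖)) := rfl

theorem logPotential_apply_of_norm_le {z : ℂ} (hz : 1 < ‖z‖) {w : ℂ} (hw : ‖w‖ ≤ 1) :
    logPotential z hz w = Real.log ‖z - w‖ := by
  have h1 := norm_sub_norm_le z w
  have h2 := norm_sub_le z w
  rw [logPotential_apply, min_eq_right (by linarith), max_eq_right (by linarith)]

theorem logPotential_le {z : ℂ} (hz : 1 < ‖z‖) {w : ℂ} {R : ℝ} (hR : ‖z‖ - 1 ≤ R)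
    (hw : ‖z - w‖ ≤ R) : logPotential z hz w ≤ Real.log R :=
  Real.log_le_log ((sub_pos.mpr hz).trans_le (le_max_left _ _))
    (max_le hR ((min_le_right _ _).trans hw))

theorem logPotential_le_log_add_one {z : ℂ} (hz : 1 < ‖z‖) (w : ℂ) :
    logPotential z hz w ≤ Real.log (‖z‖ + 1) :=
  Real.log_le_log ((sub_pos.mpr hz).trans_le (le_max_left _ _))
    (max_le (by linarith) (min_le_left _ _))

/-- Evaluate the potential at (1+δ)z: the distance to w is at most t + δ on the ball, and on the
rest the cut-off bounds the integrand by log(2+δ). -/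
theorem le_of_le_integral_logPotential {ν : Measure ℂ} [IsProbabilityMeasure ν] {L : ℝ}
    (h : ∀ (z : ℂ) (hz : 1 < ‖z‖), L ≤ ∫ w, logPotential z hz w ∂ν) {z : ℂ} (hz : ‖z‖ = 1) {t : ℝ}
    (ht : 0 ≤ t) {δ : ℝ} (hδ : 0 < δ) :
    L ≤ ν.real (Metric.closedBall z t) * Real.log (t + δ) +
      (1 - ν.real (Metric.closedBall z t)) * Real.log (2 + δ) := by
  set B := Metric.closedBall z t
  have hBm : MeasurableSet B := Metric.isClosed_closedBall.measurableSet
  have hn : ‖((1 + δ : ℝ) : ℂ) * z‖ = 1 + δ := by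
    rw [norm_mul, hz, mul_one, Complex.norm_real, Real.norm_of_nonneg (by linarith)]
  have hz' : 1 < ‖((1 + δ : ℝ) : ℂ) * z‖ := by rw [hn]; linarith
  refine (h _ hz').trans ?_
  have hg : Integrable (fun w => B.indicator (fun _ => Real.log (t + δ)) w +
      Bᶜ.indicator (fun _ => Real.log (2 + δ)) w) ν :=
    ((integrable_const _).indicator hBm).add ((integrable_const _).indicator hBm.compl)
  refine (integral_mono ((logPotential _ hz').integrable ν) hg fun w => ?_).trans ?_
  · by_cases hw : w ∈ B
    · simp only [Set.indicator_of_mem hw, Set.indicator_of_notMem (Set.notMem_compl_iff.mpr hw),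
        add_zero]
      refine logPotential_le hz' (by rw [hn]; linarith) ?_
      have h1 : ((1 + δ : ℝ) : ℂ) * z - w = (z - w) + (δ : ℂ) * z := by push_cast; ring
      rw [h1]
      refine (norm_add_le _ _).trans ?_
      rw [norm_mul, hz, mul_one, Complex.norm_real, Real.norm_of_nonneg hδ.le, ← dist_eq_norm,
        dist_comm]
      exact add_le_add_left (Metric.mem_closedBall.mp hw) _
    · simp only [Set.indicator_of_notMem hw, Set.indicator_of_mem (Set.mem_compl hw), zero_add]
      refine (logPotential_le_log_add_one hz' w).trans (le_of_eq ?_)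
      rw [hn]; ring_nf
  · rw [integral_add ((integrable_const _).indicator hBm) ((integrable_const _).indicator hBm.compl),
      integral_indicator_const _ hBm, integral_indicator_const _ hBm.compl,
      probReal_compl_eq_one_sub hBm, smul_eq_mul, smul_eq_mul]

/-- A lower bound on the logarithmic potential of a measure outside the unit disk implies
log-Hölder continuity on arcs of the circle (the Craig–Simon argument). -/
theorem logHolderBound_of_le_integral_logPotential {ν : Measure ℂ} [IsProbabilityMeasure ν] {L : ℝ}
    (h : ∀ (z : ℂ) (hz : 1 < ‖z‖), L ≤ ∫ w, logPotential z hz w ∂ν) :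
    LogHolderBound (Real.log 2 - L) ν := by
  intro A hA ht
  rcases A.eq_empty_or_nonempty with rfl | ⟨z, hz⟩
  · simp
  set t := arcLeb.real A
  have ht0 : 0 ≤ t := measureReal_nonneg
  have hz1 : ‖z‖ = 1 := by
    obtain ⟨J, -, rfl⟩ := hA
    obtain ⟨θ, -, rfl⟩ := hz
    exact Complex.norm_exp_ofReal_mul_I θ
  have hsub : A ⊆ Metric.closedBall z t := fun w hw => by
    rw [Metric.mem_closedBall, dist_eq_norm]
    exact norm_sub_le_arcLeb hA hw hz
  refine (measureReal_mono hsub).trans ?_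
  set p := ν.real (Metric.closedBall z t)
  have hp0 : 0 ≤ p := measureReal_nonneg
  have key := fun δ (hδ : 0 < δ) => le_of_le_integral_logPotential h hz1 ht0 (δ := δ) hδ
  rcases ht0.eq_or_lt with h0 | h0
  -- With the convention log 0 = 0 the bound reads 0, so a point must be shown to have no mass.
  · rw [← h0, Real.log_zero, div_zero]
    by_contra! hp
    -- Chosen so that p log δ = -(log 3 + |L| + 1), too negative for the remaining term, at most log
    -- 3, to compensate.
    set δ := Real.exp (-((Real.log 3 + |L| + 1) / p)) with hδ
    have hδ1 : δ ≤ 1 := Real.exp_le_one_iff.mpr (by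
      have : 0 ≤ Real.log 3 := Real.log_nonneg (by norm_num)
      have : 0 ≤ (Real.log 3 + |L| + 1) / p := by positivity
      linarith)
    have h1 := key δ (Real.exp_pos _)
    have h6 : Real.log (t + δ) = -((Real.log 3 + |L| + 1) / p) := by
      rw [← h0, zero_add, hδ, Real.log_exp]
    have h2 : Real.log (2 + δ) ≤ Real.log 3 :=
      Real.log_le_log (by positivity) (by linarith)
    have h3 : 0 ≤ Real.log (2 + δ) := by
      have : 0 < δ := Real.exp_pos _
      exact Real.log_nonneg (by linarith)
    have h4 : p * -((Real.log 3 + |L| + 1) / p) = -(Real.log 3 + |L| + 1) := by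
      field_simp
    have h5 := neg_abs_le L
    rw [h6] at h1
    change L ≤ p * _ + (1 - p) * Real.log (2 + δ) at h1
    rw [h4] at h1
    nlinarith
  · have hlog : Real.log t < 0 := Real.log_neg h0 (by linarith)
    have hlim : Tendsto (fun δ : ℝ => p * Real.log (t + δ) + (1 - p) * Real.log (2 + δ))
        (𝓝[>] 0) (𝓝 (p * Real.log t + (1 - p) * Real.log 2)) := by
      have : ContinuousAt (fun δ : ℝ => p * Real.log (t + δ) + (1 - p) * Real.log (2 + δ)) 0 := by
        have e1 : t + (0 : ℝ) ≠ 0 := by linarith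
        have e2 : (2 : ℝ) + 0 ≠ 0 := by norm_num
        fun_prop (disch := assumption)
      have h1 := this.tendsto
      rw [add_zero, add_zero] at h1
      exact h1.mono_left nhdsWithin_le_nhds
    have h1 : L ≤ p * Real.log t + (1 - p) * Real.log 2 :=
      ge_of_tendsto hlim (eventually_nhdsWithin_of_forall key)
    rw [le_div_iff_of_neg hlog]
    have : 0 ≤ Real.log 2 := Real.log_nonneg (by norm_num)
    nlinarith

/-! ### Passing to the limit: potentials and moments -/

section Limits

variable (a : ℤ → Disk) (l : ℤ → UCircle)

/-- The normalized power sum of a function over the eigenvalues of the Dirichlet restriction. -/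
def rootAverage {R : Type*} [AddCommMonoid R] [Module ℝ R] (n : ℕ) (h : ℂ → R) : R :=
  (2 * n + 1 : ℝ)⁻¹ • ((dirichletMatrix (pCMV a l) n).charpoly.roots.map h).sum

theorem rho_le_one (x : Disk) : rho x ≤ 1 :=
  Real.sqrt_le_one.mpr (by nlinarith [sq_nonneg ‖(x : ℂ)‖])

/-- The boundary factor ρ_{-n-1} is absorbed by comparing with the average over [-n-1, n+1]. The
extra term log ρ_{n+1} is nonpositive, so adding it only lowers the bound. -/
theorem le_of_tendsto_rootAverage {L : ℝ}
    (hL : Tendsto (fun n : ℕ => (∑ k ∈ Finset.Icc (-(n : ℤ)) n, Real.log (rho (a k))) / (2 * n + 1))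
      atTop (𝓝 L)) {z : ℂ} (hz : 1 < ‖z‖) {y : ℝ}
    (hy : Tendsto (fun n => rootAverage a l n fun w => Real.log ‖z - w‖) atTop (𝓝 y)) : L ≤ y := by
  have h1 := hL.comp (tendsto_add_atTop_nat 1)
  have h2 : Tendsto (fun n : ℕ => 1 + 2 * (2 * n + 1 : ℝ)⁻¹) atTop (𝓝 (1 + 2 * 0)) :=
    (tendsto_inv_two_mul_add_one.const_mul 2).const_add 1
  have h3 := (h1.mul h2).sub (tendsto_inv_two_mul_add_one.mul_const (Real.log ‖z‖))
  rw [mul_zero, add_zero, mul_one, zero_mul, sub_zero] at h3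
  refine le_of_tendsto_of_tendsto' h3 hy fun n => ?_
  have h4 := sum_log_rho_le_sum_log a l n hz
  have h5 : Real.log (rho (a (n + 1))) ≤ 0 := Real.log_nonpos (rho_pos _).le (rho_le_one _)
  have h6 : (-(n : ℤ) - 1) = -(n + 1) := by ring
  rw [rootAverage, smul_eq_mul, Function.comp, sum_Icc_neg_self_succ, ← h6]
  have h7 : (0 : ℝ) < 2 * n + 1 := by positivity
  have h8 : ∀ x : ℝ, x / (2 * ((n + 1 : ℕ) : ℝ) + 1) * (1 + 2 * (2 * n + 1 : ℝ)⁻¹) =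
      (2 * n + 1 : ℝ)⁻¹ * x := by
    intro x
    push_cast
    field_simp
    ring
  rw [h8, ← mul_sub]
  refine mul_le_mul_of_nonneg_left ?_ (by positivity)
  linarith

theorem integral_countingMeasure_eq_rootAverage (n : ℕ) {h h' : ℂ → ℝ}
    (hh : ∀ w, ‖w‖ < 1 → h w = h' w) :
    ∫ z, h z ∂(countingMeasure (pCMV a l) n) = rootAverage a l n h' := by
  rw [integral_countingMeasure, rootAverage]
  congr 2
  exact Multiset.map_congr rfl fun w hw => hh w (norm_root_lt_one a l n hw)

/-- All eigenvalues lie in the open disk, where the cut-off potential is the true one, so weak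
convergence can be tested on it directly. -/
theorem IsDirichletDOS.logHolderBound {ν : Measure ℂ} (hν : IsDirichletDOS (pCMV a l) ν) {L : ℝ}
    (hL : Tendsto (fun n : ℕ => (∑ k ∈ Finset.Icc (-(n : ℤ)) n, Real.log (rho (a k))) / (2 * n + 1))
      atTop (𝓝 L)) : LogHolderBound (Real.log 2 - L) ν := by
  obtain ⟨hprob, hν⟩ := hν
  refine logHolderBound_of_le_integral_logPotential fun z hz =>
    le_of_tendsto_rootAverage a l hL hz ?_
  refine (hν (logPotential z hz)).congr fun n => ?_
  exact integral_countingMeasure_eq_rootAverage a l n fun w hw =>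
    logPotential_apply_of_norm_le hz hw.le

theorem rootAverage_pow (n m : ℕ) : rootAverage a l n (fun w => w ^ m) =
    (2 * n + 1 : ℂ)⁻¹ * ((dirichletMatrix (pCMV a l) n).charpoly.roots.map (· ^ m)).sum := by
  rw [rootAverage, Complex.real_smul]
  push_cast
  rfl

theorem map_rootAverage {R R' : Type*} [AddCommGroup R] [Module ℝ R] [AddCommGroup R'] [Module ℝ R']
    (F : R →ₗ[ℝ] R') (n : ℕ) (h : ℂ → R) :
    F (rootAverage a l n h) = rootAverage a l n fun w => F (h w) := by
  rw [rootAverage, rootAverage, map_smul, map_multiset_sum, Multiset.map_map]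
  rfl

/-- Radial retraction of the plane onto the closed unit disk. -/
def diskRetract (z : ℂ) : ℂ := ((max 1 ‖z‖)⁻¹ : ℝ) * z

theorem diskRetract_of_norm_le {z : ℂ} (hz : ‖z‖ ≤ 1) : diskRetract z = z := by
  simp [diskRetract, max_eq_left hz]

theorem norm_diskRetract_le (z : ℂ) : ‖diskRetract z‖ ≤ 1 := by
  have h : 0 < max 1 ‖z‖ := lt_of_lt_of_le one_pos (le_max_left _ _)
  rw [diskRetract, norm_mul, Complex.norm_real, Real.norm_of_nonneg (inv_pos.mpr h).le,
    inv_mul_le_iff₀ h, mul_one]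
  exact le_max_right _ _

theorem continuous_diskRetract : Continuous diskRetract := by
  unfold diskRetract
  have : Continuous fun z : ℂ => (max 1 ‖z‖)⁻¹ :=
    Continuous.inv₀ (by fun_prop) fun z => (lt_of_lt_of_le one_pos (le_max_left _ _)).ne'
  fun_prop

/-- Powers are not bounded on the plane, so the test function is composed with `diskRetract`, which
changes nothing at the eigenvalues or on the circle. -/
theorem IsDirichletDOS.tendsto_rootAverage {ν : Measure ℂ} (hν : IsDirichletDOS (pCMV a l) ν)
    (hs : ν (Metric.sphere (0 : ℂ) 1)ᶜ = 0) (F : ℂ →L[ℝ] ℝ) (m : ℕ) :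
    Tendsto (fun n => rootAverage a l n fun w => F (w ^ m)) atTop (𝓝 (∫ z, F (z ^ m) ∂ν)) := by
  let h : BoundedContinuousFunction ℂ ℝ := BoundedContinuousFunction.ofNormedAddCommGroup
    (fun z => F (diskRetract z ^ m)) (F.continuous.comp (continuous_diskRetract.pow m)) ‖F‖
    fun z => by
      refine (F.le_opNorm _).trans ?_
      rw [norm_pow]
      exact mul_le_of_le_one_right (norm_nonneg _)
        (pow_le_one₀ (norm_nonneg _) (norm_diskRetract_le z))
  have hh : ∀ z, ‖z‖ ≤ 1 → h z = F (z ^ m) := fun z hz => by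
    change F (diskRetract z ^ m) = _
    rw [diskRetract_of_norm_le hz]
  have h1 : ∫ z, h z ∂ν = ∫ z, F (z ^ m) ∂ν := by
    refine integral_congr_ae ?_
    have : ∀ᵐ z ∂ν, z ∈ Metric.sphere (0 : ℂ) 1 := by rw [ae_iff]; exact hs
    filter_upwards [this] with z hz
    exact hh z (mem_sphere_zero_iff_norm.mp hz).le
  rw [← h1]
  refine (hν.2 h).congr fun n => ?_
  exact integral_countingMeasure_eq_rootAverage a l n fun w hw => hh w hw.le

theorem integrable_of_continuous {ν : Measure ℂ} [IsFiniteMeasure ν]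
    (hs : ν (Metric.sphere (0 : ℂ) 1)ᶜ = 0) {F : Type*} [NormedAddCommGroup F] {h : ℂ → F}
    (hh : Continuous h) : Integrable h ν := by
  have : ν.restrict (Metric.sphere (0 : ℂ) 1) = ν :=
    Measure.restrict_eq_self_of_ae_mem (by rw [ae_iff]; exact hs)
  rw [← this]
  exact hh.continuousOn.integrableOn_compact (isCompact_sphere 0 1)

/-- A limit of the eigenvalue counting measures that is carried by the circle is determined by
the limits of the normalized traces. -/
theorem IsDirichletDOS.eq_of_moments {ν ν' : Measure ℂ} [IsProbabilityMeasure ν]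
    (hs : ν (Metric.sphere (0 : ℂ) 1)ᶜ = 0) (hν' : IsDirichletDOS (pCMV a l) ν')
    (hs' : ν' (Metric.sphere (0 : ℂ) 1)ᶜ = 0)
    (h : ∀ m : ℕ, Tendsto (fun n => rootAverage a l n fun w => w ^ m) atTop
      (𝓝 (∫ z, z ^ m ∂ν))) : ν' = ν := by
  have hprob := hν'.1
  refine measure_eq_of_moments hs' hs fun m => ?_
  have key : ∀ F : ℂ →L[ℝ] ℝ, F (∫ z, z ^ m ∂ν') = F (∫ z, z ^ m ∂ν) := by
    intro F
    rw [← F.integral_comp_comm (integrable_of_continuous hs' (by fun_prop))]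
    refine tendsto_nhds_unique (hν'.tendsto_rootAverage a l hs' F m) ?_
    exact ((F.continuous.tendsto _).comp (h m)).congr fun n => map_rootAverage a l F.toLinearMap n _
  exact Complex.ext (key Complex.reCLM) (key Complex.imCLM)

theorem rootAverage_add {R : Type*} [AddCommGroup R] [Module ℝ R] (n : ℕ) (h h' : ℂ → R) :
    rootAverage a l n (fun w => h w + h' w) = rootAverage a l n h + rootAverage a l n h' := by
  rw [rootAverage, Multiset.sum_map_add, smul_add]
  rfl

theorem tendsto_rootAverage_eval {ν : Measure ℂ} [IsProbabilityMeasure ν]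
    (hs : ν (Metric.sphere (0 : ℂ) 1)ᶜ = 0)
    (h : ∀ m : ℕ, Tendsto (fun n => rootAverage a l n fun w => w ^ m) atTop
      (𝓝 (∫ z, z ^ m ∂ν))) (P : Polynomial ℂ) :
    Tendsto (fun n => rootAverage a l n fun w => P.eval w) atTop (𝓝 (∫ z, P.eval z ∂ν)) := by
  induction P using Polynomial.induction_on' with
  | add P Q hP hQ =>
    simp only [Polynomial.eval_add, rootAverage_add]
    rw [integral_add (integrable_of_continuous hs P.continuous)
      (integrable_of_continuous hs Q.continuous)]
    exact hP.add hQ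
  | monomial m c =>
    simp only [Polynomial.eval_monomial]
    rw [integral_const_mul]
    refine ((h m).const_mul c).congr fun n => ?_
    exact map_rootAverage a l (LinearMap.mulLeft ℝ c) n _

theorem abs_rootAverage_le (n : ℕ) {h : ℂ → ℝ} {ε : ℝ} (hh : ∀ w, ‖w‖ < 1 → |h w| ≤ ε) :
    |rootAverage a l n h| ≤ ε := by
  have hcard : ((dirichletMatrix (pCMV a l) n).charpoly.roots.card : ℝ) = 2 * n + 1 := by
    rw [Matrix.card_roots_charpoly, Fintype.card_coe, card_Icc_neg_self]
    push_cast
    rfl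
  have h1 : ∀ s : Multiset ℂ, (∀ w ∈ s, ‖w‖ < 1) → |(s.map h).sum| ≤ s.card * ε := by
    intro s
    induction s using Multiset.induction_on with
    | empty => simp
    | cons w s ih =>
      intro hs
      simp only [Multiset.map_cons, Multiset.sum_cons, Multiset.card_cons]
      push_cast
      have h2 := ih fun v hv => hs v (Multiset.mem_cons_of_mem hv)
      have h3 := hh w (hs w (Multiset.mem_cons_self w s))
      have h4 := abs_add_le (h w) (s.map h).sum
      linarith
  rw [rootAverage, smul_eq_mul, abs_mul, abs_of_pos (by positivity),
    inv_mul_le_iff₀ (by positivity), ← hcard]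
  exact h1 _ fun w => norm_root_lt_one a l n

/-- The logarithmic potential is a uniform limit on the unit disk of real parts of polynomials. -/
theorem exists_polynomial_near_log {z : ℂ} (hz : 1 < ‖z‖) {ε : ℝ} (hε : 0 < ε) :
    ∃ P : Polynomial ℂ, ∀ w, ‖w‖ ≤ 1 → |Real.log ‖z - w‖ - (P.eval w).re| ≤ ε := by
  have hz0 : z ≠ 0 := norm_pos_iff.mp (one_pos.trans hz)
  set q := ‖z‖⁻¹ with hq
  have hq1 : q < 1 := inv_lt_one_of_one_lt₀ hz
  have hq0 : 0 ≤ q := by positivity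
  have hlim : Tendsto (fun N : ℕ => q ^ (N + 1) * (1 - q)⁻¹) atTop (𝓝 (0 * (1 - q)⁻¹)) :=
    ((tendsto_pow_atTop_nhds_zero_of_lt_one hq0 hq1).comp (tendsto_add_atTop_nat 1)).mul_const _
  rw [zero_mul] at hlim
  obtain ⟨N, hN⟩ := (hlim.eventually (gt_mem_nhds hε)).exists
  -- The Taylor polynomial of log(1 - w/z), which converges uniformly on |w| ≤ 1 because |z| > 1.
  refine ⟨Polynomial.C (Real.log ‖z‖ : ℂ) + ∑ j ∈ Finset.range (N + 1),
    Polynomial.C ((-1) ^ (j + 1) * (-z⁻¹) ^ j / j) * Polynomial.X ^ j, fun w hw => ?_⟩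
  have hu : ‖-z⁻¹ * w‖ ≤ q := by
    rw [norm_mul, norm_neg, norm_inv]
    exact mul_le_of_le_one_right hq0 hw
  have hfac : z - w = z * (1 + -z⁻¹ * w) := by field_simp; ring
  have hne : 1 + -z⁻¹ * w ≠ 0 := by
    intro h0
    have : ‖-z⁻¹ * w‖ = 1 := by rw [← norm_neg, ← norm_one (α := ℂ)]; congr 1; linear_combination -h0
    linarith
  have hT := Complex.norm_log_sub_logTaylor_le N (hu.trans_lt hq1)
  have hev : (Polynomial.C (Real.log ‖z‖ : ℂ) + ∑ j ∈ Finset.range (N + 1),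
      Polynomial.C ((-1) ^ (j + 1) * (-z⁻¹) ^ j / j) * Polynomial.X ^ j).eval w =
      Real.log ‖z‖ + Complex.logTaylor (N + 1) (-z⁻¹ * w) := by
    simp only [Polynomial.eval_add, Polynomial.eval_C, Polynomial.eval_finsetSum,
      Polynomial.eval_mul, Polynomial.eval_pow, Polynomial.eval_X, Complex.logTaylor]
    congr 1
    refine Finset.sum_congr rfl fun j _ => ?_
    rw [mul_pow]
    ring
  rw [hev, hfac, norm_mul, Real.log_mul (by positivity) (norm_ne_zero_iff.mpr hne), Complex.add_re,
    Complex.ofReal_re, add_sub_add_left_eq_sub, ← Complex.log_re, ← Complex.sub_re]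
  refine (Complex.abs_re_le_norm _).trans (hT.trans (le_trans ?_ hN.le))
  have h1 : (1 : ℝ) ≤ N + 1 := by linarith [(Nat.cast_nonneg N : (0 : ℝ) ≤ N)]
  have hinv : 0 ≤ (1 - ‖-z⁻¹ * w‖)⁻¹ := inv_nonneg.mpr (by linarith)
  refine (div_le_self (by positivity) h1).trans ?_
  have : (0 : ℝ) < 1 - q := by linarith
  gcongr

/-- Convergence of holomorphic moments suffices because log|z - w| is harmonic in w near the closed
disk. No weak convergence of the counting measures is needed. -/
theorem tendsto_rootAverage_log {ν : Measure ℂ} [IsProbabilityMeasure ν]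
    (hs : ν (Metric.sphere (0 : ℂ) 1)ᶜ = 0)
    (h : ∀ m : ℕ, Tendsto (fun n => rootAverage a l n fun w => w ^ m) atTop
      (𝓝 (∫ z, z ^ m ∂ν))) {z : ℂ} (hz : 1 < ‖z‖) :
    Tendsto (fun n => rootAverage a l n fun w => Real.log ‖z - w‖) atTop
      (𝓝 (∫ w, logPotential z hz w ∂ν)) := by
  rw [Metric.tendsto_nhds]
  intro ε hε
  obtain ⟨P, hP⟩ := exists_polynomial_near_log hz (show 0 < ε / 3 by positivity)
  have hPre : Tendsto (fun n => rootAverage a l n fun w => (P.eval w).re) atTop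
      (𝓝 (∫ w, (P.eval w).re ∂ν)) := by
    have h1 : ∫ w, (P.eval w).re ∂ν = (∫ w, P.eval w ∂ν).re :=
      Complex.reCLM.integral_comp_comm (integrable_of_continuous hs P.continuous)
    rw [h1]
    exact ((Complex.continuous_re.tendsto _).comp (tendsto_rootAverage_eval a l hs h P)).congr
      fun n => map_rootAverage a l Complex.reLm n _
  have hPc : Continuous fun w => (P.eval w).re := Complex.continuous_re.comp P.continuous
  have hint : |∫ w, logPotential z hz w ∂ν - ∫ w, (P.eval w).re ∂ν| ≤ ε / 3 := by
    rw [← integral_sub ((logPotential z hz).integrable ν) (integrable_of_continuous hs hPc)]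
    have hb : ∀ᵐ w ∂ν, ‖logPotential z hz w - (P.eval w).re‖ ≤ ε / 3 := by
      have : ∀ᵐ z ∂ν, z ∈ Metric.sphere (0 : ℂ) 1 := by rw [ae_iff]; exact hs
      filter_upwards [this] with w hw
      have hw1 := (mem_sphere_zero_iff_norm.mp hw).le
      rw [logPotential_apply_of_norm_le hz hw1]
      exact hP w hw1
    have h1 := norm_integral_le_of_norm_le_const hb
    rwa [probReal_univ, mul_one] at h1
  filter_upwards [Metric.tendsto_nhds.mp hPre (ε / 3) (by positivity)] with n hn
  have h1 := abs_rootAverage_le a l n (h := fun w => Real.log ‖z - w‖ + -(P.eval w).re)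
    (ε := ε / 3) fun w hw => by rw [← sub_eq_add_neg]; exact hP w hw.le
  have h2 := map_rootAverage a l (-LinearMap.id : ℝ →ₗ[ℝ] ℝ) n fun w => (P.eval w).re
  simp only [LinearMap.neg_apply, LinearMap.id_apply] at h2
  rw [rootAverage_add, ← h2] at h1
  rw [Real.dist_eq] at hn ⊢
  rw [abs_le] at h1 hint
  rw [abs_lt] at hn ⊢
  constructor <;> linarith [h1.1, h1.2, hint.1, hint.2, hn.1, hn.2]

theorem logHolderBound_of_moments {ν : Measure ℂ} [IsProbabilityMeasure ν]
    (hs : ν (Metric.sphere (0 : ℂ) 1)ᶜ = 0)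
    (h : ∀ m : ℕ, Tendsto (fun n => rootAverage a l n fun w => w ^ m) atTop
      (𝓝 (∫ z, z ^ m ∂ν))) {L : ℝ}
    (hL : Tendsto (fun n : ℕ => (∑ k ∈ Finset.Icc (-(n : ℤ)) n, Real.log (rho (a k))) / (2 * n + 1))
      atTop (𝓝 L)) : LogHolderBound (Real.log 2 - L) ν :=
  logHolderBound_of_le_integral_logPotential fun _ hz =>
    le_of_tendsto_rootAverage a l hL hz (tendsto_rootAverage_log a l hs h hz)

end Limits

end PCMV

/-! ### Almost sure convergence of the ergodic averages -/

namespace PCMV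

section Ergodic

variable {Ω : Type*} [MeasurableSpace Ω] {μ : Measure Ω} [IsProbabilityMeasure μ] {S : Ω ≃ᵐ Ω}

theorem tendsto_sum_Icc_complex (hS : Ergodic S μ) {G : Ω → ℂ} (hGm : Measurable G)
    (hG : Integrable G μ) :
    ∀ᵐ x ∂μ, Tendsto (fun n : ℕ => (2 * n + 1 : ℂ)⁻¹ *
      ∑ k ∈ Finset.Icc (-(n : ℤ)) n, G ((S.toEquiv ^ k : Equiv.Perm Ω) x))
      atTop (𝓝 (∫ x, G x ∂μ)) := by
  filter_upwards [hS.tendsto_sum_Icc_div (Complex.measurable_re.comp hGm) hG.re,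
    hS.tendsto_sum_Icc_div (Complex.measurable_im.comp hGm) hG.im] with x h1 h2
  have h3 := ((Complex.continuous_ofReal.tendsto _).comp h1).add
    (((Complex.continuous_ofReal.tendsto _).comp h2).mul_const Complex.I)
  have h4 : ((∫ x, (Complex.re ∘ G) x ∂μ : ℝ) : ℂ) + (∫ x, (Complex.im ∘ G) x ∂μ : ℝ) * Complex.I =
      ∫ x, G x ∂μ := integral_re_add_im hG
  rw [h4] at h3
  refine h3.congr fun n => ?_
  simp only [Function.comp]
  rw [← Complex.re_add_im (∑ k ∈ Finset.Icc (-(n : ℤ)) n, G ((S.toEquiv ^ k : Equiv.Perm Ω) x)),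
    Complex.re_sum, Complex.im_sum]
  push_cast
  ring

theorem two_mul_sum_Icc (x : ℤ → ℂ) (n : ℕ) :
    2 * ∑ k ∈ Finset.Icc (-(n : ℤ)) n, x k =
      ∑ k ∈ Finset.Icc (-(n : ℤ)) n, (x k + x (k + 1)) + (x (-n) - x (n + 1)) := by
  induction n with
  | zero => simp; ring
  | succ n ih =>
    rw [sum_Icc_neg_self_succ, sum_Icc_neg_self_succ, mul_add, ih,
      show -((n : ℤ) + 1) + 1 = -n by ring]
    push_cast
    ring

/-- Almost surely, the normalized traces of the powers converge to deterministic limits. -/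
theorem tendsto_avgTrace_pow (hS : Ergodic S μ) {f : Ω → Disk} (hf : Measurable f)
    {g : Ω → UCircle} (hg : Measurable g) (m : ℕ) :
    ∀ᵐ ω ∂μ, Tendsto (fun n => avgTrace n (dynPCMV S f g ω ^ m)) atTop
      (𝓝 ((∫ ω, pairTrace (dynPCMV S f g ω ^ m) 0 ∂μ) / 2)) := by
  have hm := measurable_pairTrace S hf hg m 0
  have hi : Integrable (fun ω => pairTrace (dynPCMV S f g ω ^ m) 0) μ :=
    Integrable.of_bound hm.aestronglyMeasurable 2
      (ae_of_all _ fun ω => norm_pairTrace_le (dynPCMV_mem_unitary S f g ω) m 0)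
  filter_upwards [tendsto_sum_Icc_complex hS hm hi] with ω h
  set x : ℤ → ℂ := fun k => (dynPCMV S f g ω ^ m) (delta k) k with hx
  have hx1 : ∀ k, ‖x k‖ ≤ 1 := norm_diag_pow_le (dynPCMV_mem_unitary S f g ω) m
  -- Half the sum of the pair traces counts every diagonal entry once, up to two bounded boundary
  -- terms.
  have h1 := (h.div_const 2).add
    (tendsto_inv_mul_of_bounded (x := fun n => (x (-n) - x (n + 1)) / 2) (C := 1) fun n => by
      rw [norm_div, Complex.norm_ofNat, div_le_one two_pos]
      exact (norm_sub_le _ _).trans (by linarith [hx1 (-n), hx1 (n + 1)]))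
  rw [add_zero] at h1
  refine h1.congr fun n => ?_
  have h2 := two_mul_sum_Icc x n
  simp only [← pairTrace_dynPCMV]
  rw [avgTrace_apply]
  simp only [inner_delta_left]
  change _ = (2 * n + 1 : ℂ)⁻¹ * ∑ k ∈ Finset.Icc (-(n : ℤ)) n, x k
  change (2 * n + 1 : ℂ)⁻¹ * (∑ k ∈ Finset.Icc (-(n : ℤ)) n, (x k + x (k + 1))) / 2 + _ = _
  linear_combination (-(2 * n + 1 : ℂ)⁻¹ / 2) * h2

theorem log_rho (x : Disk) : Real.log (rho x) = (1 / 2) * Real.log (1 - ‖(x : ℂ)‖ ^ 2) := by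
  have h : ‖(x : ℂ)‖ < 1 := mem_ball_zero_iff.mp x.2
  rw [rho, Real.log_sqrt (by nlinarith [norm_nonneg (x : ℂ)])]
  ring

theorem log_rhoInf (μ : Measure Ω) (f : Ω → Disk) :
    Real.log (rhoInf μ f) = ∫ ω, Real.log (rho (f ω)) ∂μ := by
  simp only [log_rho]
  rw [rhoInf, Real.log_exp, integral_const_mul]

/-- The bound |f| ≤ C < 1 keeps ρ away from 0, so log ρ is bounded. -/
theorem integrable_log_rho {f : Ω → Disk} (hf : Measurable f)
    (hC : ∃ C : ℝ, C < 1 ∧ ∀ᵐ ω ∂μ, ‖(f ω : ℂ)‖ ≤ C) :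
    Integrable (fun ω => Real.log (rho (f ω))) μ := by
  obtain ⟨C, hC1, hC⟩ := hC
  obtain ⟨ω₀, hω₀⟩ := hC.exists
  have hC0 : 0 ≤ C := (norm_nonneg _).trans hω₀
  have hlow : 0 < Real.sqrt (1 - C ^ 2) := Real.sqrt_pos.mpr (by nlinarith)
  refine Integrable.of_bound
    (Real.measurable_log.comp (measurable_rho_comp hf)).aestronglyMeasurable
    (-Real.log (Real.sqrt (1 - C ^ 2))) ?_
  filter_upwards [hC] with ω hω
  rw [Real.norm_eq_abs, abs_of_nonpos (Real.log_nonpos (rho_pos _).le (rho_le_one _))]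
  refine neg_le_neg (Real.log_le_log hlow (Real.sqrt_le_sqrt ?_))
  have := pow_le_pow_left₀ (norm_nonneg _) hω 2
  linarith

end Ergodic

end PCMV

end

/-! ### Assembly of the main theorem -/

theorem theorem2p5 {Ω : Type*} [MeasurableSpace Ω] (μ : Measure Ω) [IsProbabilityMeasure μ]
    (S : Ω ≃ᵐ Ω) (hS : Ergodic S μ)
    (f : Ω → PCMV.Disk) (hf : Measurable f) (g : Ω → PCMV.UCircle) (hg : Measurable g)
    (hC : ∃ C : ℝ, C < 1 ∧ ∀ᵐ ω ∂μ, ‖(f ω : ℂ)‖ ≤ C) :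
    0 < Real.log (2 / PCMV.rhoInf μ f) ∧
    ∃ ν : Measure ℂ,
      (∀ᵐ ω ∂μ, PCMV.IsDOS (PCMV.dynPCMV S f g ω) ν) ∧
      PCMV.LogHolderBound (Real.log (2 / PCMV.rhoInf μ f)) ν ∧
      ∀ᵐ ω ∂μ, ∀ ν' : Measure ℂ, PCMV.IsDirichletDOS (PCMV.dynPCMV S f g ω) ν' →
        PCMV.LogHolderBound (Real.log (2 / PCMV.rhoInf μ f)) ν' ∧
        (ν' (Metric.sphere (0 : ℂ) 1)ᶜ = 0 → ν' = ν) := by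
  have hlog : Real.log (2 / PCMV.rhoInf μ f) =
      Real.log 2 - ∫ ω, Real.log (PCMV.rho (f ω)) ∂μ := by
    have h : PCMV.rhoInf μ f ≠ 0 := Real.exp_ne_zero _
    rw [Real.log_div two_ne_zero h, PCMV.log_rhoInf]
  have hL := hS.tendsto_sum_Icc_div (Real.measurable_log.comp (PCMV.measurable_rho_comp hf))
    (PCMV.integrable_log_rho hf hC)
  have htr : ∀ᵐ ω ∂μ, ∀ m : ℕ, Tendsto (fun n => PCMV.avgTrace n (PCMV.dynPCMV S f g ω ^ m)) atTop
      (𝓝 ((∫ ω, PCMV.pairTrace (PCMV.dynPCMV S f g ω ^ m) 0 ∂μ) / 2)) :=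
    ae_all_iff.mpr fun m => PCMV.tendsto_avgTrace_pow hS hf hg m
  -- The limiting moments do not depend on ω, so a measure built from one typical ω₀ serves almost
  -- every ω.
  obtain ⟨ω₀, hω₀⟩ := htr.exists
  obtain ⟨ν, hν, hs, hmom⟩ :=
    PCMV.exists_measure_of_moments (PCMV.dynPCMV_mem_unitary S f g ω₀) hω₀
  simp only [← hmom] at htr
  have hroots : ∀ᵐ ω ∂μ, ∀ m : ℕ, Tendsto (fun n => PCMV.rootAverage
      (fun n => f ((S.toEquiv ^ n : Equiv.Perm Ω) ω))
      (fun n => g ((S.toEquiv ^ n : Equiv.Perm Ω) ω)) n fun w => w ^ m) atTop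
      (𝓝 (∫ z, z ^ m ∂ν)) := by
    filter_upwards [htr] with ω hω m
    simp only [PCMV.rootAverage_pow]
    refine PCMV.tendsto_sum_roots_pow_of_tendsto _ _ m ?_
    have h := hω m
    simp only [PCMV.avgTrace_apply, PCMV.inner_delta_left] at h
    exact h
  rw [hlog]
  refine ⟨?_, ν, ?_, ?_, ?_⟩
  · have h1 : ∫ ω, Real.log (PCMV.rho (f ω)) ∂μ ≤ 0 := integral_nonpos fun ω =>
      Real.log_nonpos (PCMV.rho_pos _).le (PCMV.rho_le_one _)
    have h2 : 0 < Real.log 2 := Real.log_pos one_lt_two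
    linarith
  · filter_upwards [htr] with ω hω
    exact PCMV.isDOS_of_moments (PCMV.dynPCMV_mem_unitary S f g ω) hs hω
  -- The measure ν is deterministic, so one ω with both limits suffices.
  · obtain ⟨ω₁, h1, h2⟩ := (hroots.and hL).exists
    exact PCMV.logHolderBound_of_moments _ _ hs h1 h2
  · filter_upwards [hroots, hL] with ω h1 h2 ν' hν'
    exact ⟨hν'.logHolderBound _ _ h2, fun hs' => hν'.eq_of_moments _ _ hs hs' h1⟩
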